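/- **Setting.** Let $K$ be a division ring and $V\neq K$ a total valuation ring of $K$ (a subring such that $k\in V$ or $k^{-1}\in V$ for every nonzero $k\in K$). Let $\sigma:\mathbb Q\to\mathrm{Aut}(K)$ be a group homomorphism, write $a^{\sigma(r)}=\sigma(r)(a)$, and let $K[\mathbb Q,\sigma]=\bigoplus_{r}KX^r$ be the skew group ring, with $(aX^r)(cX^s)=a\,c^{\sigma(r)}X^{r+s}$. Let $A=\bigoplus_{r\in\mathbb Q}A_rX^r$ be a graded extension of $V$, that is, a graded subring of $K[\mathbb Q,\sigma]$ with $A_0=V$ which contains $aX^r$ or $(aX^r)^{-1}$ for every $r\in\mathbb Q$ and every nonzero $a\in K$. For an additive subgroup $I$ of $K$ let $O_l(I)=\{a\in K: aI\subseteq I\}$; a product of two additive subgroups is the set of finite sums of products. Put $W=\bigcup_{r\in\mathbb Q}O_l(A_r)$ (a subring of $K$), and let $J(\cdot)$ denote the Jacobson radical. For $s>0$ let $H_s=\bigoplus_{i\in\mathbb Z}A_{is}X^{is}$. * $H_s$ is of Type (II) if there are $g,h\in s\mathbb Z$, $g,h>0$, with $A_gA_h^{\sigma(g)}\ne A_{g+h}$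 or $A_{-g}A_{-h}^{\sigma(-g)}\neq A_{-g-h}$. * $H_s$ is of Type (e) if, with $U=O_l(A_s)$, there is a nonzero $a\in K$ with $A_s=Ua=aU^{\sigma(s)}$ and $A_{-s}=J(U)(a^{-1})^{\sigma(-s)}$, and $J(U)=Uc^{-1}$ for some nonzero $c\in K$. * $A$ is of Type (e) if $H_s$ is of Type (II) for some $s>0$ and $J(W)=b^{-1}W$ for some nonzero $b\in K$. For an additive group $G$, a *graded map* $f:G\to\mathbb Z$ is a map with $f(0)=0$, $f(s)+f(t)\le f(s+t)$ and $f(s)+f(-s)\ge-1$ for all $s,t\in G$. For $r>0$, a graded map $f:\mathbb Zr\to\mathbb Z$ is *nice* if $f(r)=0$ and $f(-r)=-1$. For $d\in\mathbb R$ the maps $f_d,f_d^{(1)},f_d^{(-1)}:\mathbb Q\to\mathbb Z$ are given by $f_d(r)=\lfloor rd\rfloor$ for all $r$; $f_d^{(\pm1)}(0)=0$; and for $r>0$ by $rd-1\le f_d^{(1)}(r)<rd$, $f_d^{(-1)}(r)=\lfloor rd\rfloor$, and $f_d^{(\pm1)}(-r)=-f_d^{(\pm1)}(r)-1$. **Lemma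 4.11.** Let $A$ be of Type (e), let $b\in K$ be nonzero with $J(W)=b^{-1}W$, and assume that $O_l(A_t)=W$ for some $t\in\mathbb Q$. Then there is a positive integer $l$ such that $H_{1/l}$ is of Type (e) and $O_l(A_{1/l})=W$. Fix any such $l$. For $r=n_1/m_1\in\mathbb Q$ in lowest terms ($m_1>0$) put $q=lm_1$ and $$l_r=\sup_{n\ge1}g_{1/(nq)}(r),\qquad k_r=\sup_{n\ge1}h_{1/(nq)}(r)\qquad\text{in }\mathbb Z\cup\{+\infty\},$$ where $g_{1/(nq)}:\tfrac1{nq}\mathbb Z\to\mathbb Z$ is the nice map such that, with $s=\frac1{nq}$ and some nonzero $\beta\in K$ with $WA_s=W\beta=\beta W^{\sigma(s)}$, $$WA_{is}=Wb^{\,g_{1/(nq)}(is)}\gamma_i\quad(i\in\mathbb Z),\qquad \gamma_i=\beta\beta^{\sigma(s)}\cdots\beta^{\sigma((i-1)s)}\ (i\ge0),\quad \gamma_{-i}=(\gamma_i^{-1})^{\sigma(-is)}\ (i> 0),$$ and $h_{1/(nq)}$ is obtained in the same way with $A_r,\sigma(r)$ replaced by $A_{-r},\sigma(-r)$ for all $r$.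 Assume that $l_m<+\infty$ or $k_m<+\infty$ for some rational $m>0$. Then there exist a nonzero graded map $f:\mathbb Q\to\mathbb Z$ and elements $\alpha_r\in K$ $(r\in\mathbb Q)$ with $\alpha_0=1$ such that for all $r,s\in\mathbb Q$ $$WA_r=Wb^{f(r)}\alpha_r,\qquad W\alpha_r=\alpha_rW^{\sigma(r)},\qquad (W\alpha_r)(W\alpha_s)^{\sigma(r)}=W\alpha_r\alpha_s^{\sigma(r)}=W\alpha_{r+s}.$$ Furthermore, if $l_m<+\infty$ for some rational $m>0$, then $f=f_0^{(-1)}$, or $f\in\{f_d,f_d^{(1)},f_d^{(-1)}\}$ for some real $d>0$. If $k_m<+\infty$ for some rational $m>0$, then $f=f_0^{(1)}$, or $f\in\{f_d,f_d^{(1)},f_d^{(-1)}\}$ for some real $d<0$. -/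

import Mathlib

open scoped Pointwise

namespace GradedExt

noncomputable section

/-! ### The skew group ring and its graded total subrings

A group homomorphism `σ : ℚ → Aut(K)` is the same thing as an action of the group
`Multiplicative ℚ` on `K` by ring automorphisms. -/

/-- The automorphism `σ(r)` of `K`. -/
def sigma (K : Type*) [DivisionRing K] [MulSemiringAction (Multiplicative ℚ) K] (r : ℚ) :
    K ≃+* K :=
  MulSemiringAction.toRingEquiv (Multiplicative ℚ) K (Multiplicative.ofAdd r)

/-- The skew group ring `K[ℚ, σ]`. -/
abbrev SkewGroupRing (K : Type*) [DivisionRing K] [MulSemiringAction (Multiplicative ℚ) K] :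
    Type _ :=
  SkewMonoidAlgebra K (Multiplicative ℚ)

variable {K : Type*} [DivisionRing K] [MulSemiringAction (Multiplicative ℚ) K]

/-- The homogeneous element `a X^r` of `K[ℚ, σ]`. -/
def hom (r : ℚ) (a : K) : SkewGroupRing K :=
  SkewMonoidAlgebra.single (Multiplicative.ofAdd r) a

/-- The multiplication rule `(a X^r)(c X^s) = a c^{σ(r)} X^{r+s}`. -/
theorem hom_mul_hom (r s : ℚ) (a c : K) :
    hom r a * hom s c = hom (r + s) (a * sigma K r c) :=
  SkewMonoidAlgebra.single_mul_single

/-- `V` is a total valuation ring of `K`. -/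
def IsTotalValuationRing (V : Subring K) : Prop :=
  ∀ k : K, k ≠ 0 → k ∈ V ∨ k⁻¹ ∈ V

/-- `A` is a graded extension of `V` in `K[ℚ, σ]`: a graded subring which contains every nonzero
homogeneous element or its inverse, and whose part of degree `0` is `V`. -/
structure IsGradedExtension (V : Subring K) (A : Subring (SkewGroupRing K)) : Prop where
  graded : ∀ x ∈ A, ∀ r : ℚ, hom r (x.coeff (Multiplicative.ofAdd r)) ∈ A
  total : ∀ (r : ℚ) (a : K), a ≠ 0 →
    hom r a ∈ A ∨ ∃ y ∈ A, hom r a * y = 1 ∧ y * hom r a = 1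
  zero_mem_iff : ∀ a : K, hom 0 a ∈ A ↔ a ∈ V

/-- The component `A_r = {a ∈ K | a X^r ∈ A}`. -/
def comp (A : Subring (SkewGroupRing K)) (r : ℚ) : AddSubgroup K :=
  A.toAddSubgroup.comap (SkewMonoidAlgebra.singleAddHom (Multiplicative.ofAdd r))

theorem mem_comp {A : Subring (SkewGroupRing K)} {r : ℚ} {a : K} :
    a ∈ comp A r ↔ hom r a ∈ A := Iff.rfl

/-! ### Products, left orders, the ring `W` and its radical -/

/-- The product of two subsets of `K`: all finite sums of products. -/
def prod (S T : Set K) : Set K := (AddSubgroup.closure (S * T) : Set K)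

/-- The left order `O_l(I) = {a ∈ K | a I ⊆ I}`. -/
def leftOrder (I : AddSubgroup K) : Subring K where
  carrier := {a | ∀ x ∈ I, a * x ∈ I}
  mul_mem' {a c} ha hc x hx := by
    rw [mul_assoc]
    exact ha _ (hc x hx)
  one_mem' x hx := by simpa using hx
  add_mem' {a c} ha hc x hx := by
    rw [add_mul]
    exact I.add_mem (ha x hx) (hc x hx)
  zero_mem' x _ := by simp
  neg_mem' {a} ha x hx := by
    rw [neg_mul]
    exact I.neg_mem (ha x hx)

/-- The ring `W` generated by all left orders `W_r = O_l(A_r)`. For a graded extension of a total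
valuation ring it is their union, see `coe_bigW`. -/
def bigW (A : Subring (SkewGroupRing K)) : Subring K := ⨆ r : ℚ, leftOrder (comp A r)

theorem le_leftOrder {V : Subring K} {A : Subring (SkewGroupRing K)}
    (hA : IsGradedExtension V A) (r : ℚ) : V ≤ leftOrder (comp A r) := by
  intro v hv x hx
  have h := A.mul_mem ((hA.zero_mem_iff v).2 hv) (mem_comp.1 hx)
  rw [hom_mul_hom] at h
  have h0 : sigma K 0 x = x := by simp [sigma]
  rw [h0, zero_add] at h
  exact h

/-- The overrings of a total valuation ring form a chain. -/
theorem overring_total {F : Type*} [DivisionRing F] {V : Subring F} (hV : IsTotalValuationRing V) {R S : Subring F}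
    (hR : V ≤ R) (hS : V ≤ S) : R ≤ S ∨ S ≤ R := by
  by_contra hcon
  rw [not_or, SetLike.not_le_iff_exists, SetLike.not_le_iff_exists] at hcon
  obtain ⟨⟨x, hxR, hxS⟩, ⟨y, hyS, hyR⟩⟩ := hcon
  have hx : x ≠ 0 := fun h => hxS (h ▸ S.zero_mem)
  have hy : y ≠ 0 := fun h => hyR (h ▸ R.zero_mem)
  rcases hV (x * y⁻¹) (mul_ne_zero hx (inv_ne_zero hy)) with h | h
  · exact hxS (by simpa [mul_assoc, hy] using S.mul_mem (hS h) hyS)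
  · exact hyR (by simpa [mul_assoc, hx] using R.mul_mem (hR h) hxR)

/-- `W = ⋃_r O_l(A_r)`. -/
theorem coe_bigW {V : Subring K} (hV : IsTotalValuationRing V) {A : Subring (SkewGroupRing K)}
    (hA : IsGradedExtension V A) :
    (bigW A : Set K) = ⋃ r : ℚ, (leftOrder (comp A r) : Set K) := by
  apply Subring.coe_iSup_of_directed
  intro r s
  rcases overring_total hV (le_leftOrder hA r) (le_leftOrder hA s) with h | h
  · exact ⟨s, h, le_rfl⟩
  · exact ⟨r, le_rfl, h⟩

/-- The Jacobson radical `J(W)`, as a subset of `K`. -/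
def radical (W : Subring K) : Set K := Subtype.val '' (Ring.jacobson W : Set W)

/-- The set `W c`. -/
def leftMul (W : Subring K) (c : K) : Set K := (W : Set K) * {c}

/-- The set `c W^{σ(r)}`. -/
def rightMul (W : Subring K) (r : ℚ) (c : K) : Set K := {c} * (sigma K r '' (W : Set K))

/-- The left `W`-module `W A_r`, where `W = ⋃_s O_l(A_s)`. -/
def WA (A : Subring (SkewGroupRing K)) (r : ℚ) : Set K := prod (bigW A : Set K) (comp A r)

/-! ### Types of graded extensions

For `s > 0` let `H_s = ⊕_{i ∈ ℤ} A_{is} X^{is}`, a graded extension of `V` in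
`K[X^s, X^{-s}; σ(s)]`. -/

/-- `H_s` is of Type (II). -/
def IsTypeII (A : Subring (SkewGroupRing K)) (s : ℚ) : Prop :=
  ∃ i j : ℕ, 0 < i ∧ 0 < j ∧
    (prod (comp A (i * s)) (sigma K (i * s) '' (comp A (j * s))) ≠
        comp A (i * s + j * s) ∨
      prod (comp A (-(i * s))) (sigma K (-(i * s)) '' (comp A (-(j * s)))) ≠
        comp A (-(i * s) - j * s))

/-- `H_s` is of Type (e): with `U = O_l(A_s)`, one has `A_s = U a = a U^{σ(s)}`,
`A_{-s} = J(U) (a⁻¹)^{σ(-s)}`, and `J(U) = U c⁻¹` for some `c`. -/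
def IsCyclicTypeE (A : Subring (SkewGroupRing K)) (s : ℚ) : Prop :=
  (∃ a : K, a ≠ 0 ∧
    (comp A s : Set K) = leftMul (leftOrder (comp A s)) a ∧
    (comp A s : Set K) = rightMul (leftOrder (comp A s)) s a ∧
    (comp A (-s) : Set K) = radical (leftOrder (comp A s)) * {sigma K (-s) a⁻¹}) ∧
  ∃ c : K, c ≠ 0 ∧ radical (leftOrder (comp A s)) = leftMul (leftOrder (comp A s)) c⁻¹

/-- `A` is of Type (e): some `H_s` with `s > 0` is of Type (II), and `J(W) = c⁻¹ W` for some
`c`. -/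
def IsTypeE (A : Subring (SkewGroupRing K)) : Prop :=
  (∃ s : ℚ, 0 < s ∧ IsTypeII A s) ∧
  ∃ c : K, c ≠ 0 ∧ radical (bigW A) = {c⁻¹} * (bigW A : Set K)

/-! ### Graded maps -/

/-- Graded maps `f : G → ℤ`. -/
def IsGradedMap {G : Type*} [AddGroup G] (f : G → ℤ) : Prop :=
  f 0 = 0 ∧ (∀ s t, f s + f t ≤ f (s + t)) ∧ ∀ s, -1 ≤ f s + f (-s)

/-- Nice maps on `ℤ s`, where the element `i s` of `ℤ s` is represented by `i`. -/
def IsNiceMap (g : ℤ → ℤ) : Prop := IsGradedMap g ∧ g 1 = 0 ∧ g (-1) = -1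

/-- `f_d(r) = [r d]`. -/
def fMap (d : ℝ) (r : ℚ) : ℤ := ⌊(r : ℝ) * d⌋

/-- `f_d^{(1)}`: for `r > 0` its value at `r` is the integer `x` with `r d - 1 ≤ x < r d`, and its
value at `-r` is `-x - 1`. -/
def fMapPos (d : ℝ) (r : ℚ) : ℤ :=
  if 0 < r then ⌈(r : ℝ) * d⌉ - 1
  else if r < 0 then -(⌈((-r : ℚ) : ℝ) * d⌉ - 1) - 1
  else 0

/-- `f_d^{(-1)}`: for `r > 0` its value at `r` is `[r d]`, and its value at `-r` is
`-[r d] - 1`. -/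
def fMapNeg (d : ℝ) (r : ℚ) : ℤ :=
  if 0 < r then ⌊(r : ℝ) * d⌋
  else if r < 0 then -⌊((-r : ℚ) : ℝ) * d⌋ - 1
  else 0

/-! ### The numbers `l_r` and `k_r` -/

/-- `γ_i = β β^{σ(s)} ⋯ β^{σ((i-1)s)}` for `i ≥ 0`. -/
def gammaNat (s : ℚ) (β : K) : ℕ → K
  | 0 => 1
  | i + 1 => gammaNat s β i * sigma K (i * s) β

/-- `γ_i` as above for `i ≥ 0`, and `γ_{-i} = (γ_i⁻¹)^{σ(-is)}`. -/
def gamma (s : ℚ) (β : K) (i : ℤ) : K :=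
  if 0 ≤ i then gammaNat s β i.toNat
  else sigma K (i * s) (gammaNat s β (-i).toNat)⁻¹

/-- `g` is the nice map belonging to the step `s` (which may be negative): for some `β` with
`W A_s = W β = β W^{σ(s)}` and for all integers `i`, `W A_{is} = W b^{g(i)} γ_i`. -/
def IsNiceMapAt (A : Subring (SkewGroupRing K)) (b : K) (s : ℚ) (g : ℤ → ℤ) : Prop :=
  IsNiceMap g ∧ ∃ β : K, β ≠ 0 ∧
    WA A s = leftMul (bigW A) β ∧ leftMul (bigW A) β = rightMul (bigW A) s β ∧
    ∀ i : ℤ, WA A (i * s) = leftMul (bigW A) (b ^ g i * gamma s β i)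

/-- `l` is a positive integer such that `H_{1/l}` is of Type (e) with `O_l(A_{1/l}) = W`. -/
def IsBase (A : Subring (SkewGroupRing K)) (l : ℕ) : Prop :=
  0 < l ∧ IsCyclicTypeE A (1 / l) ∧ leftOrder (comp A (1 / l)) = bigW A

/-- `l_r = sup_n g_{1/(nq)}(r)`, where `r = n₁/m₁` in lowest terms, `q = l m₁`, and `r` is the
multiple of `1/(nq)` by `n n₁ l`. -/
def lSup (A : Subring (SkewGroupRing K)) (b : K) (l : ℕ) (r : ℚ) : EReal :=
  sSup {x | ∃ n : ℕ, 0 < n ∧ ∃ g : ℤ → ℤ, IsNiceMapAt A b (1 / (n * (l * r.den))) g ∧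
    x = (((g (n * r.num * l) : ℤ) : ℝ) : EReal)}

/-- `k_r = sup_n h_{1/(nq)}(r)`: the same with `A_r`, `σ(r)` replaced by `A_{-r}`, `σ(-r)`. -/
def kSup (A : Subring (SkewGroupRing K)) (b : K) (l : ℕ) (r : ℚ) : EReal :=
  sSup {x | ∃ n : ℕ, 0 < n ∧ ∃ h : ℤ → ℤ, IsNiceMapAt A b (-(1 / (n * (l * r.den)))) h ∧
    x = (((h (n * r.num * l) : ℤ) : ℝ) : EReal)}

end

end GradedExt

/-! Pass to the group `G = Kˣ ⋊ ℚ` of homogeneous units `a X^r`. Let `W` denote also the degree-zero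
units with coefficient in `W`, let `E` be the normalizer of `W` in `G`, and let `U` be the group of
units of `W`. Since `b⁻¹` generates the radical, `b` lies in `E`, is central modulo `U`
(`commutator_mem_U`) and has infinite order there.

The existence of `t` with `O_l(A_t) = W` makes every `W A_r` principal with a generator `y_r` in `E`
(`exists_generator_mem_E`). Moreover `y_{r+s}` equals `y_r y_s` or `b y_r y_s` modulo `U`
(`mul_mem_or`). So in `E / U` the `y_r` form a section of a central extension of `ℚ` by the powers
of `b`, with cocycle in `{0, 1}`. The nice map of step `s` is the exponent `g` in `y_{is} = b^{g(i)}
y_s^i`.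

If these exponents stay bounded at a fixed positive degree under refinement of the step, a step
attaining the maximum has compatible roots of all orders, so the extension splits
(`exists_splitting`). A splitting `f` gives `α_r = b^{-f(r)} y_r`, and the cocycle bound makes `f` a
graded map. A finite `k_m` is the same situation for the section `r ↦ y_{-r}`.

Graded maps on `ℚ` lie within distance one below a line `r ↦ r d`; how they touch the two bounding
lines leaves three possibilities (`classification`). The boundedness assumption fixes the sign of
`d` (`exists_nonneg`). Finally `H_{1/l}` is of Type (e) with left order `W` whenever `y_{1/l}
y_{-1/l}` is not in `U`. If this failed for every `l`, the section would be additive, and no `H_s`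
could be of Type (II). -/

namespace GradedExt

/-! ### Graded maps on `ℚ` and their classification. -/

namespace IsGradedMap

variable {f : ℚ → ℤ}

theorem map_add_le (hf : IsGradedMap f) (r s : ℚ) : f (r + s) ≤ f r + f s + 1 := by
  have h1 := hf.2.1 (r + s) (-s)
  have h2 := hf.2.2 s
  rw [add_neg_cancel_right] at h1
  omega

theorem add_neg_le (hf : IsGradedMap f) (r : ℚ) : f r + f (-r) ≤ 0 := by
  have h := hf.2.1 r (-r)
  rw [add_neg_cancel, hf.1] at h
  exact h

theorem mul_le (hf : IsGradedMap f) (r : ℚ) (n : ℕ) : n * f r ≤ f (n * r) := by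
  induction n with
  | zero => simp [hf.1]
  | succ n ih =>
    have h := hf.2.1 (n * r) r
    push_cast
    rw [add_one_mul, add_one_mul]
    omega

theorem map_mul_le (hf : IsGradedMap f) (r : ℚ) (n : ℕ) : f (n * r) ≤ n * (f r + 1) := by
  induction n with
  | zero => simp [hf.1]
  | succ n ih =>
    have h := hf.map_add_le (n * r) r
    push_cast
    rw [add_one_mul, add_one_mul]
    omega

theorem exists_common_multiple {r s : ℚ} (hr : 0 < r) (hs : 0 < s) :
    ∃ n m : ℕ, 0 < n ∧ 0 < m ∧ (n : ℚ) * r = m * s := by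
  have hq : 0 < s / r := by positivity
  refine ⟨(s / r).num.toNat, (s / r).den, ?_, Rat.den_pos _, ?_⟩
  · have := Rat.num_pos.2 hq
    omega
  · have h1 : (((s / r).num.toNat : ℕ) : ℚ) = (s / r).num := by
      have h2 : (((s / r).num.toNat : ℕ) : ℤ) = (s / r).num :=
        Int.toNat_of_nonneg (Rat.num_pos.2 hq).le
      exact_mod_cast h2
    have hd : ((s / r).den : ℚ) ≠ 0 := by exact_mod_cast (s / r).den_nz
    have h := Rat.num_div_den (s / r)
    rw [div_eq_div_iff hd hr.ne'] at h
    rw [h1, h]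
    ring

/-- Evaluate `f` at a common multiple `n r = m s`, bounding it below through `r` and above through
`s`. This bounds every slope `f r / r` by every `(f s + 1) / s`. -/
theorem mul_le_mul (hf : IsGradedMap f) {r s : ℚ} (hr : 0 < r) (hs : 0 < s) :
    (f r : ℚ) * s ≤ (f s + 1) * r := by
  obtain ⟨n, m, hn, hm, h⟩ := exists_common_multiple hr hs
  have h1 := hf.mul_le r n
  have h2 := hf.map_mul_le s m
  rw [h] at h1
  have h3 : (n : ℚ) * f r ≤ m * (f s + 1) := by exact_mod_cast h1.trans h2
  have hm' : (0 : ℚ) < m := by exact_mod_cast hm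
  refine le_of_mul_le_mul_left ?_ hm'
  calc (m : ℚ) * (f r * s) = (n * f r) * r := by rw [mul_comm (f r : ℚ), ← mul_assoc, ← h]; ring
    _ ≤ (m * (f s + 1)) * r := by gcongr
    _ = _ := by ring

theorem exists_slope (hf : IsGradedMap f) :
    ∃ d : ℝ, ∀ r : ℚ, (f r : ℝ) ≤ r * d ∧ r * d ≤ f r + 1 := by
  let T : Set ℝ := {x | ∃ r : ℚ, 0 < r ∧ x = (f r : ℝ) / r}
  have hle : ∀ r s : ℚ, 0 < r → 0 < s → (f r : ℝ) / r ≤ (f s + 1) / s := by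
    intro r s hr hs
    have hr' : (0 : ℝ) < r := by exact_mod_cast hr
    have hs' : (0 : ℝ) < s := by exact_mod_cast hs
    rw [div_le_div_iff₀ hr' hs']
    exact_mod_cast hf.mul_le_mul hr hs
  have hpos : ∀ r : ℚ, 0 < r → (f r : ℝ) ≤ r * sSup T ∧ r * sSup T ≤ f r + 1 := by
    intro r hr
    have hr' : (0 : ℝ) < r := by exact_mod_cast hr
    constructor
    · rw [← div_le_iff₀' hr']
      refine le_csSup ⟨(f r + 1) / r, ?_⟩ ⟨r, hr, rfl⟩
      rintro _ ⟨s, hs, rfl⟩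
      exact hle s r hs hr
    · rw [← le_div_iff₀' hr']
      refine csSup_le ⟨_, r, hr, rfl⟩ ?_
      rintro _ ⟨s, hs, rfl⟩
      exact hle s r hs hr
  refine ⟨sSup T, fun r => ?_⟩
  rcases lt_trichotomy 0 r with hr | rfl | hr
  · exact hpos r hr
  · simp [hf.1]
  · obtain ⟨h1, h2⟩ := hpos (-r) (by linarith)
    have h3 := hf.add_neg_le r
    have h4 := hf.2.2 r
    rcases eq_or_ne (f r + f (-r)) 0 with h | h
    -- When `f r = -f (-r)`, the claim at `r` needs `f (-r)` to lie on the line, not just within one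
    -- of it. Passing to multiples `n r` shows that the gap is at most `1 / n` for every positive
    -- `n`.
    · have h5 : ∀ n : ℕ, (n : ℝ) * (((-r : ℚ) : ℝ) * sSup T - f (-r)) ≤ 1 := by
        intro n
        rcases n.eq_zero_or_pos with rfl | hn
        · simp
        have hn' : (0 : ℚ) < n := by exact_mod_cast hn
        have h6 := hf.mul_le r n
        have h7 := hf.add_neg_le (n * r)
        have h8 := (hpos (n * -r) (mul_pos hn' (by linarith))).2
        have h9 : f (n * -r) ≤ n * f (-r) := by
          rw [mul_neg]
          have : (n : ℤ) * f r + n * f (-r) = 0 := by rw [← mul_add, h, mul_zero]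
          omega
        have h9' : (f (n * -r) : ℝ) ≤ n * f (-r) := by exact_mod_cast h9
        push_cast at h8 ⊢
        linarith
      have h6 : ((-r : ℚ) : ℝ) * sSup T ≤ f (-r) := by
        by_contra! hlt
        obtain ⟨n, hn⟩ := exists_nat_gt (1 / (((-r : ℚ) : ℝ) * sSup T - f (-r)))
        rw [div_lt_iff₀ (by linarith)] at hn
        exact absurd (h5 n) (by linarith)
      have h7 : (f r : ℝ) = -f (-r) := by exact_mod_cast (show f r = -f (-r) by omega)
      rw [h7]
      push_cast at h1 h6
      constructor <;> linarith
    · have h7 : (f r : ℝ) = -f (-r) - 1 := by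
        exact_mod_cast (show f r = -f (-r) - 1 by omega)
      rw [h7]
      push_cast at h1 h2
      constructor <;> linarith

variable {d : ℝ}

/-- The set of degrees where a graded map is exactly linear is stable under commensurability. -/
theorem eq_of_commensurable (hf : IsGradedMap f)
    {r s : ℚ} {n m : ℕ} (hm : 0 < m)
    (h : (n : ℚ) * r = m * s) (hr : (f r : ℝ) = r * d) : (s : ℝ) * d ≠ f s + 1 := by
  intro hs
  have h1 := hf.mul_le r n
  rw [h] at h1
  have h2 := hf.2.2 s
  have h3 := hf.mul_le (-s) (m - 1)
  have h4 := hf.2.1 (m * s) ((m - 1 : ℕ) * -s)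
  -- If the upper line is met at `s`, then `f (m s) ≥ m (f s + 1)`. Descending by `m - 1` steps
  -- `-s`, each losing at most `f s + 1`, gives `f s ≥ f s + 1`.
  have h5 : (m : ℚ) * s + (m - 1 : ℕ) * -s = s := by
    rw [Nat.cast_sub hm]
    push_cast
    ring
  rw [h5] at h4
  have h6 : (n : ℝ) * f r = m * (f s + 1) := by
    rw [hr, ← hs, ← mul_assoc, ← mul_assoc]
    congr 1
    exact_mod_cast h
  have h7 : (n : ℤ) * f r = m * (f s + 1) := by exact_mod_cast h6
  have h8 : ((m - 1 : ℕ) : ℤ) = m - 1 := by omega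
  rw [h8] at h3
  have h9 : (0 : ℤ) ≤ m - 1 := by omega
  nlinarith

theorem eq_of_add_neg (hd : ∀ r : ℚ, (f r : ℝ) ≤ r * d ∧ r * d ≤ f r + 1) {r : ℚ}
    (h : f r + f (-r) = 0) : (f r : ℝ) = r * d := by
  have h1 := (hd r).1
  have h2 := (hd (-r)).1
  have h3 : (f r : ℝ) + f (-r) = 0 := by exact_mod_cast h
  push_cast at h2
  linarith

/-- Classification of the graded maps on `ℚ`. -/
theorem classification (hf : IsGradedMap f)
    (hd : ∀ r : ℚ, (f r : ℝ) ≤ r * d ∧ r * d ≤ f r + 1) :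
    f = fMap d ∨ f = fMapPos d ∨ f = fMapNeg d := by
  -- Such an `r` puts `f` on the lower line at both `r` and `-r`, so by commensurability the upper
  -- line is met nowhere and `f` is a floor.
  by_cases h1 : ∃ r : ℚ, 0 < r ∧ f r + f (-r) = 0
  · left
    obtain ⟨r, hr, h⟩ := h1
    have hr1 := eq_of_add_neg hd h
    have hr2 := eq_of_add_neg hd (r := -r) (by rw [neg_neg, add_comm]; exact h)
    funext s
    have key : (s : ℝ) * d ≠ f s + 1 := by
      rcases lt_trichotomy 0 s with hs | rfl | hs
      · obtain ⟨n, m, -, hm, hnm⟩ := exists_common_multiple hr hs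
        exact hf.eq_of_commensurable hm hnm hr1
      · simp [hf.1]
      · obtain ⟨n, m, -, hm, hnm⟩ := exists_common_multiple hr (neg_pos.2 hs)
        exact hf.eq_of_commensurable (n := n) hm (by linarith) hr2
    exact (Int.floor_eq_iff.2 ⟨(hd s).1, lt_of_le_of_ne (hd s).2 key⟩).symm
  · push Not at h1
    have hneg : ∀ r : ℚ, 0 < r → f (-r) = -f r - 1 := by
      intro r hr
      have := h1 r hr
      have := hf.add_neg_le r
      have := hf.2.2 r
      omega
    right
    -- The values at negative degrees are now determined by the positive ones. On positive degrees,
    -- meeting the lower line once excludes the upper line (floor); never meeting it gives the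
    -- ceiling minus one.
    by_cases h2 : ∃ r : ℚ, 0 < r ∧ (f r : ℝ) = r * d
    · right
      obtain ⟨r, hr, h⟩ := h2
      have hpos : ∀ s : ℚ, 0 < s → f s = ⌊(s : ℝ) * d⌋ := by
        intro s hs
        obtain ⟨n, m, -, hm, hnm⟩ := exists_common_multiple hr hs
        have key := hf.eq_of_commensurable hm hnm h
        exact (Int.floor_eq_iff.2 ⟨(hd s).1, lt_of_le_of_ne (hd s).2 key⟩).symm
      funext s
      rw [fMapNeg]
      split_ifs with h3 h4
      · exact hpos s h3
      · rw [← hpos (-s) (by linarith), ← hneg (-s) (by linarith), neg_neg]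
      · rw [show s = 0 by linarith, hf.1]
    · left
      push Not at h2
      have hpos : ∀ s : ℚ, 0 < s → f s = ⌈(s : ℝ) * d⌉ - 1 := by
        intro s hs
        have : ⌈(s : ℝ) * d⌉ = f s + 1 := by
          rw [Int.ceil_eq_iff]
          push_cast
          exact ⟨by linarith [lt_of_le_of_ne (hd s).1 (h2 s hs)], (hd s).2⟩
        omega
      funext s
      rw [fMapPos]
      split_ifs with h3 h4
      · exact hpos s h3
      · rw [← hpos (-s) (by linarith), ← hneg (-s) (by linarith), neg_neg]
      · rw [show s = 0 by linarith, hf.1]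

/-- A negative slope contradicts `0 ≤ f s ≤ s d`. For slope zero, `fMap 0` is the zero map and
`fMapPos 0` equals `-1` at positive degrees. -/
theorem classification_of_pos (hf : IsGradedMap f) (h0 : f ≠ 0) {s : ℚ} (hs : 0 < s)
    (hfs : 0 ≤ f s) :
    f = fMapNeg 0 ∨ ∃ d : ℝ, 0 < d ∧ (f = fMap d ∨ f = fMapPos d ∨ f = fMapNeg d) := by
  obtain ⟨d, hd⟩ := hf.exists_slope
  have hc := hf.classification hd
  have hs' : (0 : ℝ) < s := by exact_mod_cast hs
  have hfs' : (0 : ℝ) ≤ f s := by exact_mod_cast hfs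
  rcases lt_trichotomy 0 d with h | rfl | h
  · exact Or.inr ⟨d, h, hc⟩
  · left
    rcases hc with h | h | h
    · exact absurd (h.trans (by funext r; simp [fMap])) h0
    · rw [h] at hfs
      simp [fMapPos, hs] at hfs
    · exact h
  · nlinarith [(hd s).1]

theorem classification_of_neg (hf : IsGradedMap f) (h0 : f ≠ 0) {s : ℚ} (hs : s < 0)
    (hfs : 0 ≤ f s) :
    f = fMapPos 0 ∨ ∃ d : ℝ, d < 0 ∧ (f = fMap d ∨ f = fMapPos d ∨ f = fMapNeg d) := by
  obtain ⟨d, hd⟩ := hf.exists_slope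
  have hc := hf.classification hd
  have hs' : (s : ℝ) < 0 := by exact_mod_cast hs
  have hfs' : (0 : ℝ) ≤ f s := by exact_mod_cast hfs
  rcases lt_trichotomy 0 d with h | rfl | h
  · nlinarith [(hd s).1]
  · left
    rcases hc with h | h | h
    · exact absurd (h.trans (by funext r; simp [fMap])) h0
    · exact h
    · rw [h] at hfs
      simp [fMapNeg, hs, hs.not_gt] at hfs
  · exact Or.inr ⟨d, h, hc⟩

end IsGradedMap
end GradedExt

/-! ### Central extensions of `ℚ` by `ℤ` with cocycle in `{0, 1}`. -/

namespace GradedExt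

/-- Data of a central extension of `ℚ` by `ℤ` with a section whose cocycle takes values in
`{0, 1}`. -/
structure CentralSection (Γ : Type*) [Group Γ] where
  z : Γ
  B : ℚ → Γ
  central : ∀ g, z * g = g * z
  zpow_inj : ∀ n : ℤ, z ^ n = 1 → n = 0
  B_zero : B 0 = 1
  mul : ∀ r s, B (r + s) = B r * B s ∨ B (r + s) = z * (B r * B s)

namespace CentralSection

variable {Γ : Type*} [Group Γ] (S : CentralSection Γ)

theorem zpow_cancel {m n : ℤ} {g : Γ} (h : S.z ^ m * g = S.z ^ n * g) : m = n := by
  have h1 : S.z ^ (m - n) = 1 := by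
    rw [zpow_sub, mul_right_cancel h, mul_inv_cancel]
  have := S.zpow_inj _ h1
  omega

theorem commute_zpow (n : ℤ) (g : Γ) : S.z ^ n * g = g * S.z ^ n :=
  ((show Commute S.z g from S.central g).zpow_left n).eq

theorem exists_cocycle (r s : ℚ) :
    ∃ c : ℤ, 0 ≤ c ∧ c ≤ 1 ∧ B S (r + s) = S.z ^ c * (B S r * B S s) := by
  rcases S.mul r s with h | h
  · exact ⟨0, le_rfl, zero_le_one, by simpa using h⟩
  · exact ⟨1, zero_le_one, le_rfl, by simpa using h⟩

theorem zpow_mul_mul (m n : ℤ) (g h : Γ) :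
    (S.z ^ m * g) * (S.z ^ n * h) = S.z ^ (m + n) * (g * h) := by
  rw [zpow_add, mul_assoc, ← mul_assoc g, ← S.commute_zpow n g]
  simp only [mul_assoc]

theorem exists_step_nat (s : ℚ) (n : ℕ) : ∃ g : ℤ, S.B (n * s) = S.z ^ g * S.B s ^ n := by
  induction n with
  | zero => exact ⟨0, by simp [S.B_zero]⟩
  | succ n ih =>
    obtain ⟨g, hg⟩ := ih
    obtain ⟨c, -, -, hc⟩ := S.exists_cocycle (n * s) s
    refine ⟨c + g, ?_⟩
    rw [Nat.cast_succ, add_one_mul, hc, hg, zpow_add, pow_succ]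
    simp only [mul_assoc]

theorem exists_step (s : ℚ) (i : ℤ) : ∃ g : ℤ, S.B (i * s) = S.z ^ g * S.B s ^ i := by
  obtain ⟨n, rfl | rfl⟩ := i.eq_nat_or_neg
  · simpa using S.exists_step_nat s n
  · obtain ⟨g, hg⟩ := S.exists_step_nat s n
    obtain ⟨c, -, -, hc⟩ := S.exists_cocycle (n * s) (-(n * s))
    rw [add_neg_cancel, S.B_zero, hg, mul_assoc, ← mul_assoc (S.z ^ c), ← zpow_add] at hc
    refine ⟨-(c + g), ?_⟩
    have h2 := eq_inv_of_mul_eq_one_right (a := S.z ^ (c + g) * S.B s ^ n)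
      (b := S.B (-(n * s))) (by rw [hc]; simp only [mul_assoc])
    rw [Int.cast_neg, Int.cast_natCast, neg_mul, h2, mul_inv_rev, zpow_neg, zpow_neg,
      ← zpow_neg S.z, S.commute_zpow, zpow_neg, zpow_natCast]

/-- The exponent `g` with `B (i s) = z ^ g * B s ^ i`. -/
noncomputable def step (s : ℚ) (i : ℤ) : ℤ := (S.exists_step s i).choose

theorem step_spec (s : ℚ) (i : ℤ) : S.B (i * s) = S.z ^ S.step s i * S.B s ^ i :=
  (S.exists_step s i).choose_spec

theorem step_unique {s : ℚ} {i g : ℤ} (h : S.B (i * s) = S.z ^ g * S.B s ^ i) :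
    S.step s i = g :=
  S.zpow_cancel ((S.step_spec s i).symm.trans h)

theorem step_zero (s : ℚ) : S.step s 0 = 0 := S.step_unique (by simp [S.B_zero])

theorem step_one (s : ℚ) : S.step s 1 = 0 := S.step_unique (by simp)

theorem step_add (s : ℚ) (i j : ℤ) : S.step s (i + j) = S.step s i + S.step s j ∨
    S.step s (i + j) = S.step s i + S.step s j + 1 := by
  obtain ⟨c, h0, h1, hc⟩ := S.exists_cocycle (i * s) (j * s)
  have : S.step s (i + j) = c + (S.step s i + S.step s j) := by
    apply S.step_unique
    rw [Int.cast_add, add_mul, hc, S.step_spec s i, S.step_spec s j, S.zpow_mul_mul, zpow_add S.z c,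
      zpow_add (S.B s)]
    simp only [mul_assoc]
  omega

theorem isGradedMap_step (s : ℚ) : IsGradedMap (S.step s) := by
  refine ⟨S.step_zero s, fun i j => ?_, fun i => ?_⟩
  · rcases S.step_add s i j with h | h <;> omega
  · have h0 := S.step_zero s
    rcases S.step_add s i (-i) with h | h <;> rw [add_neg_cancel] at h <;> omega

/-- The cocycle bound leaves only `0` and `-1` for the value at `-1`, and `0` would mean `B (-s) =
(B s)⁻¹`. -/
theorem isNiceMap_step {s : ℚ} (hs : S.B s * S.B (-s) ≠ 1) : IsNiceMap (S.step s) := by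
  refine ⟨S.isGradedMap_step s, S.step_one s, ?_⟩
  have h0 := S.step_zero s
  have h1 := S.step_one s
  rcases S.step_add s 1 (-1) with h | h <;> rw [add_neg_cancel] at h
  · exfalso
    have h2 : S.step s (-1) = 0 := by omega
    have h3 := S.step_spec s (-1)
    rw [h2] at h3
    apply hs
    rw [show -s = ((-1 : ℤ) : ℚ) * s by simp, h3]
    simp
  · omega

theorem step_nonneg (s : ℚ) (n : ℕ) : 0 ≤ S.step s n := by
  induction n with
  | zero => simp [S.step_zero]
  | succ n ih =>
    have h1 := S.step_one s
    push_cast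
    rcases S.step_add s n 1 with h | h <;> omega

/-- The chain rule for refining a step: raise `B (i s) = z ^ g * B s ^ i` to the power `j`, using
that `z` is central. -/
theorem step_mul (s : ℚ) (i j : ℤ) :
    S.step s (i * j) = S.step (i * s) j + j * S.step s i := by
  apply S.step_unique
  have h := S.step_spec (i * s) j
  rw [show ((i * j : ℤ) : ℚ) * s = j * (i * s) by push_cast; ring, h, S.step_spec s i,
    (show Commute (S.z ^ S.step s i) (S.B s ^ i) from S.commute_zpow _ _).mul_zpow,
    ← zpow_mul, ← zpow_mul, mul_comm j, zpow_add, mul_assoc]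

/-- If the steps to a fixed positive element are bounded, the extension splits. -/
theorem exists_splitting {p q : ℕ} (hp : 0 < p) (hq : 0 < q) {C : ℤ}
    (hC : ∀ n : ℕ, 0 < n → S.step (1 / (n * q)) (n * p) ≤ C) :
    ∃ f : ℚ → ℤ, ∀ r s, S.z ^ (-f (r + s)) * S.B (r + s) =
      (S.z ^ (-f r) * S.B r) * (S.z ^ (-f s) * S.B s) := by
  obtain ⟨_, ⟨n₀, hn₀, rfl⟩, hmax⟩ := Int.exists_greatest_of_bdd
    (P := fun x => ∃ n : ℕ, 0 < n ∧ S.step (1 / (n * q)) (n * p) = x)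
    ⟨C, by rintro _ ⟨n, hn, rfl⟩; exact hC n hn⟩ ⟨_, 1, one_pos, rfl⟩
  set s₀ : ℚ := 1 / (n₀ * q) with hs₀
  have hs₀pos : 0 < s₀ := by positivity
  -- By the chain rule, refining `s₀` to `s₀ / k` adds `n₀ p · step (s₀ / k) k ≥ 0` to the maximal
  -- value, so this term vanishes. Hence `B (s₀ / k)` is an exact `k`-th root of `B s₀`.
  have hroot : ∀ k : ℕ, 0 < k → S.step (s₀ / k) k = 0 := by
    intro k hk
    have h1 := S.step_mul (s₀ / k) k (n₀ * p)
    have hk' : (k : ℚ) ≠ 0 := by positivity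
    rw [Int.cast_natCast, mul_div_cancel₀ _ hk'] at h1
    have h2 := hmax _ ⟨k * n₀, by positivity, rfl⟩
    rw [show (1 : ℚ) / ((k * n₀ : ℕ) * q) = s₀ / k by rw [hs₀]; push_cast; field_simp,
      show ((k * n₀ : ℕ) : ℤ) * p = k * (n₀ * p) by push_cast; ring, h1] at h2
    have h3 := S.step_nonneg (s₀ / k) k
    have h4 : (0 : ℤ) < n₀ * p := by positivity
    nlinarith
  have hroot' : ∀ k k' : ℕ, 0 < k → 0 < k' → S.step (s₀ / (k * k')) k' = 0 := by
    intro k k' hk hk'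
    have h1 := S.step_mul (s₀ / (k * k')) k' k
    have hk1 : (k : ℚ) ≠ 0 := by positivity
    have hk2 : (k' : ℚ) ≠ 0 := by positivity
    have h2 := hroot (k * k') (by positivity)
    rw [show ((k' : ℤ) : ℚ) * (s₀ / (k * k')) = s₀ / k by push_cast; field_simp,
      hroot k hk] at h1
    push_cast at h2
    rw [mul_comm (k' : ℤ), h2] at h1
    have h4 : (0 : ℤ) < k := by positivity
    rcases mul_eq_zero.1 (show (k : ℤ) * S.step (s₀ / (k * k')) k' = 0 by omega) with h | h
    · omega
    · exact h
  have hstep : ∀ (k k' : ℕ) (i : ℤ), 0 < k → 0 < k' →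
      S.step (s₀ / (k * k')) (k' * i) = S.step (s₀ / k) i := by
    intro k k' i hk hk'
    have hk1 : (k : ℚ) ≠ 0 := by positivity
    have hk2 : (k' : ℚ) ≠ 0 := by positivity
    rw [S.step_mul, hroot' k k' hk hk', mul_zero, add_zero,
      show ((k' : ℤ) : ℚ) * (s₀ / (k * k')) = s₀ / k by push_cast; field_simp]
  have hwd : ∀ (k k' : ℕ) (i i' : ℤ), 0 < k → 0 < k' → (i : ℚ) * (s₀ / k) = i' * (s₀ / k') →
      S.step (s₀ / k) i = S.step (s₀ / k') i' := by
    intro k k' i i' hk hk' h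
    have hk1 : (k : ℚ) ≠ 0 := by positivity
    have hk2 : (k' : ℚ) ≠ 0 := by positivity
    have h1 : k' * i = k * i' := by
      field_simp at h
      have : (k' : ℚ) * i = k * i' := by linarith
      exact_mod_cast this
    rw [← hstep k k' i hk hk', ← hstep k' k i' hk' hk, h1, mul_comm (k : ℚ)]
  have hrep : ∀ r : ℚ, ((r / s₀).num : ℚ) * (s₀ / (r / s₀).den) = r := by
    intro r
    have h := Rat.num_div_den (r / s₀)
    have hd : ((r / s₀).den : ℚ) ≠ 0 := by exact_mod_cast (r / s₀).den_nz
    rw [div_eq_div_iff hd hs₀pos.ne'] at h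
    field_simp
    linarith
  let f : ℚ → ℤ := fun r => S.step (s₀ / (r / s₀).den) (r / s₀).num
  have hf : ∀ (k : ℕ) (i : ℤ), 0 < k → f (i * (s₀ / k)) = S.step (s₀ / k) i :=
    fun k i hk => hwd _ _ _ _ (Rat.den_pos _) hk (hrep _)
  -- On multiples of `s₀ / k` the corrected section is a power map. Any two rationals are multiples
  -- of one such `s₀ / k`, so it is a homomorphism on `ℚ`.
  have hφ : ∀ (k : ℕ) (i : ℤ), 0 < k →
      S.z ^ (-f (i * (s₀ / k))) * S.B (i * (s₀ / k)) = S.B (s₀ / k) ^ i := by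
    intro k i hk
    rw [hf k i hk, S.step_spec, ← mul_assoc, ← zpow_add, neg_add_cancel, zpow_zero, one_mul]
  refine ⟨f, fun r s => ?_⟩
  set k := (r / s₀).den
  set k' := (s / s₀).den
  have hk : 0 < k := Rat.den_pos _
  have hk' : 0 < k' := Rat.den_pos _
  have hk1 : (k : ℚ) ≠ 0 := by positivity
  have hk2 : (k' : ℚ) ≠ 0 := by positivity
  have hr : r = ((k' * (r / s₀).num : ℤ) : ℚ) * (s₀ / (k * k' : ℕ)) := by
    conv_lhs => rw [← hrep r]
    push_cast
    field_simp
    rfl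
  have hs : s = ((k * (s / s₀).num : ℤ) : ℚ) * (s₀ / (k * k' : ℕ)) := by
    conv_lhs => rw [← hrep s]
    push_cast
    field_simp
    rfl
  have hkk : 0 < k * k' := by positivity
  have h1 := hφ _ (k' * (r / s₀).num) hkk
  have h2 := hφ _ (k * (s / s₀).num) hkk
  have h3 := hφ _ (k' * (r / s₀).num + k * (s / s₀).num) hkk
  rw [← hr] at h1
  rw [← hs] at h2
  rw [Int.cast_add, add_mul, ← hr, ← hs] at h3
  rw [h1, h2, h3, zpow_add]

/-- The section along the opposite direction. -/
def opposite : CentralSection Γ where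
  z := S.z
  B r := S.B (-r)
  central := S.central
  zpow_inj := S.zpow_inj
  B_zero := by simpa using S.B_zero
  mul r s := by
    rw [neg_add]
    exact S.mul _ _

theorem step_opposite (s : ℚ) (i : ℤ) : S.opposite.step s i = S.step (-s) i := by
  apply S.opposite.step_unique
  have h := S.step_spec (-s) i
  rwa [mul_neg] at h

end CentralSection
end GradedExt

/-! ### Homogeneous units, the normalizer `E` of `W` and the units `U`. -/

namespace GradedExt

/-- The multiplicative data carried by a graded extension: the group of homogeneous units with its
degree `d`, the total cone `P` of the units in the extension, the monoid `W` of the elements of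
degree `0` lying in the left order of some component, and a generator `b⁻¹` of the set of
non-units of `W`. -/
structure GradedCone (G : Type*) [Group G] where
  d : G → ℚ
  d_mul : ∀ g h, d (g * h) = d g + d h
  P : Submonoid G
  total : ∀ g, g ∈ P ∨ g⁻¹ ∈ P
  W : Submonoid G
  mem_W : ∀ a, a ∈ W ↔ d a = 0 ∧ ∃ r, ∀ p ∈ P, d p = r → a * p ∈ P
  b : G
  d_b : d b = 0
  mem_J : ∀ a, (a ∈ W ∧ a⁻¹ ∉ W) ↔ b * a ∈ W

namespace GradedCone

variable {G : Type*} [Group G] (S : GradedCone G)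

theorem d_one : S.d 1 = 0 := by
  have := S.d_mul 1 1
  rw [mul_one] at this
  linarith

theorem d_inv (g : G) : S.d g⁻¹ = -S.d g := by
  have := S.d_mul g g⁻¹
  rw [mul_inv_cancel, S.d_one] at this
  linarith

theorem d_pow (g : G) (n : ℕ) : S.d (g ^ n) = n * S.d g := by
  induction n with
  | zero => simp [S.d_one]
  | succ n ih => rw [pow_succ, S.d_mul, ih]; push_cast; ring

theorem d_zpow (g : G) (n : ℤ) : S.d (g ^ n) = n * S.d g := by
  obtain ⟨n, rfl | rfl⟩ := n.eq_nat_or_neg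
  · simpa using S.d_pow g n
  · simp [S.d_inv, S.d_pow]

theorem d_conj (g a : G) : S.d (g * a * g⁻¹) = S.d a := by
  rw [S.d_mul, S.d_mul, S.d_inv]
  ring

variable {S}

theorem d_of_mem {a : G} (ha : a ∈ S.W) : S.d a = 0 := ((S.mem_W a).1 ha).1

theorem mem_W_of_mem_P {a : G} (ha : a ∈ S.P) (h : S.d a = 0) : a ∈ S.W :=
  (S.mem_W a).2 ⟨h, 0, fun _ hp _ => S.P.mul_mem ha hp⟩

theorem inv_mem_P {a : G} (ha : a ∉ S.P) : a⁻¹ ∈ S.P := (S.total a).resolve_left ha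

theorem inv_mem_W {a : G} (h : S.d a = 0) (ha : a ∉ S.W) : a⁻¹ ∈ S.W :=
  mem_W_of_mem_P (inv_mem_P fun hp => ha (mem_W_of_mem_P hp h)) (by rw [S.d_inv, h, neg_zero])

theorem b_notMem : S.b ∉ S.W := fun h => by
  have := (S.mem_J 1).2 (by simpa using h)
  simp [S.W.one_mem] at this

theorem b_inv_mem : S.b⁻¹ ∈ S.W :=
  ((S.mem_J S.b⁻¹).2 (by simp [S.W.one_mem])).1

theorem b_mul_mem_of_notMem {a : G} (h : S.d a = 0) (ha : a ∉ S.W) : S.b * a⁻¹ ∈ S.W :=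
  (S.mem_J a⁻¹).1 ⟨inv_mem_W h ha, by simpa using ha⟩

/-- The elements `j` of `W` with `j⁻¹ ∉ W` lie in the cone. -/
theorem mem_P_of_b_mul_mem {j : G} (h : S.b * j ∈ S.W) : j ∈ S.P := by
  obtain ⟨h1, h2⟩ := (S.mem_J j).2 h
  by_contra hj
  exact h2 (mem_W_of_mem_P (inv_mem_P hj) (by rw [S.d_inv, d_of_mem h1, neg_zero]))

variable (S)

/-- The stabilizer of `W` under conjugation. -/
def E : Subgroup G where
  carrier := {g | ∀ a, a ∈ S.W ↔ g * a * g⁻¹ ∈ S.W}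
  one_mem' := by simp
  mul_mem' {g h} hg hh a := by
    rw [hh a, hg]
    simp only [mul_assoc, mul_inv_rev]
  inv_mem' {g} hg a := by
    rw [hg (g⁻¹ * a * g⁻¹⁻¹)]
    simp only [mul_assoc, inv_inv, mul_inv_cancel, mul_one, mul_inv_cancel_left]

/-- The units of `W`. -/
def U : Subgroup G where
  carrier := {a | a ∈ S.W ∧ a⁻¹ ∈ S.W}
  one_mem' := by simp [S.W.one_mem]
  mul_mem' {g h} hg hh := ⟨S.W.mul_mem hg.1 hh.1, by
    rw [mul_inv_rev]; exact S.W.mul_mem hh.2 hg.2⟩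
  inv_mem' {g} hg := ⟨hg.2, by simpa using hg.1⟩

variable {S}

theorem U_le_E : S.U ≤ S.E := by
  intro u hu a
  constructor
  · intro h
    exact S.W.mul_mem (S.W.mul_mem hu.1 h) hu.2
  · intro h
    have := S.W.mul_mem (S.W.mul_mem hu.2 h) hu.1
    simpa [mul_assoc] using this

theorem conj_mem {g a : G} (hg : g ∈ S.E) (ha : a ∈ S.W) : g * a * g⁻¹ ∈ S.W := (hg a).1 ha

theorem conj_mem_U {g u : G} (hg : g ∈ S.E) (hu : u ∈ S.U) : g * u * g⁻¹ ∈ S.U :=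
  ⟨conj_mem hg hu.1, by simpa [mul_assoc] using conj_mem hg hu.2⟩

/-- The non-units `b⁻¹ W` of `W` are stable under left multiplication by `W`, whence `b W b⁻¹ ⊆ W`.
Conversely, if `b a b⁻¹ ∈ W`, then `a b⁻¹` is a non-unit of `W`, while `a ∉ W` would put its inverse
`b a⁻¹` in `W`. -/
theorem b_mem_E : S.b ∈ S.E := by
  intro a
  constructor
  · intro ha
    rw [mul_assoc]
    refine (S.mem_J _).1 ⟨S.W.mul_mem ha b_inv_mem, fun h => b_notMem (S := S) ?_⟩
    simpa using S.W.mul_mem h ha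
  · intro h
    by_contra ha
    have hd : S.d a = 0 := by
      have := d_of_mem h
      rwa [S.d_conj] at this
    rw [mul_assoc] at h
    have := ((S.mem_J _).2 h).2
    rw [mul_inv_rev, inv_inv] at this
    exact this (b_mul_mem_of_notMem hd ha)

theorem mem_U_of_notMem {w : G} (hw : w ∈ S.W) (h : S.b * w ∉ S.W) : w ∈ S.U := by
  by_contra hu
  exact h ((S.mem_J w).1 ⟨hw, fun hi => hu ⟨hw, hi⟩⟩)

theorem b_mul_conj_mem {e : G} (he : e ∈ S.E) : S.b * (e * S.b⁻¹ * e⁻¹) ∈ S.W := by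
  refine (S.mem_J _).1 ⟨conj_mem he b_inv_mem, fun h => ?_⟩
  simp only [mul_inv_rev, inv_inv, ← mul_assoc] at h
  exact b_notMem ((he _).2 h)

/-- Conjugation by `e` preserves the non-units of `W`, so it can change their generator `b⁻¹` only
by a unit. Thus `b` is central modulo `U`. -/
theorem commutator_mem_U {e : G} (he : e ∈ S.E) : S.b * e * S.b⁻¹ * e⁻¹ ∈ S.U := by
  refine ⟨by simpa [mul_assoc] using b_mul_conj_mem he, ?_⟩
  have := conj_mem he (b_mul_conj_mem (S.E.inv_mem he))
  simpa [mul_assoc] using this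

theorem d_of_mem_U {u : G} (hu : u ∈ S.U) : S.d u = 0 := d_of_mem hu.1

variable (S)

/-- The localization `⋃ k, W b ^ k`. -/
def O : Submonoid G where
  carrier := {g | ∃ k : ℕ, g * S.b⁻¹ ^ k ∈ S.W}
  one_mem' := ⟨0, by simp [S.W.one_mem]⟩
  mul_mem' {g h} := by
    rintro ⟨k, hk⟩ ⟨l, hl⟩
    refine ⟨l + k, ?_⟩
    have h1 := S.W.mul_mem hk (conj_mem (S.E.pow_mem b_mem_E k) hl)
    simpa [mul_assoc, pow_add] using h1

variable {S}

theorem W_le_O : S.W ≤ S.O := fun w hw => ⟨0, by simpa using hw⟩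

theorem b_mem_O : S.b ∈ S.O := ⟨1, by simp [S.W.one_mem]⟩

theorem conj_mem_O {e g : G} (he : e ∈ S.E) (hg : g ∈ S.O) : e * g * e⁻¹ ∈ S.O := by
  obtain ⟨k, hk⟩ := hg
  have h1 : e * g * e⁻¹ = (e * (g * S.b⁻¹ ^ k) * e⁻¹) * (e * S.b * e⁻¹) ^ k := by
    rw [conj_pow]
    simp [mul_assoc]
  rw [h1]
  refine S.O.mul_mem (W_le_O (conj_mem he hk)) (S.O.pow_mem ?_ k)
  refine ⟨1, ?_⟩
  have := (commutator_mem_U he).2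
  simpa [mul_assoc] using this

/-- An element of `O` whose inverse is in `O` is a power of `b` up to a unit of `W`; in
particular it stabilizes `W`. -/
theorem mem_E_of_mem_O {z : G} (hz : z ∈ S.O) (hz' : z⁻¹ ∈ S.O) : z ∈ S.E := by
  -- A non-unit `x` of `W` can be replaced by `b x ∈ W`, which lowers `n` by one; the process ends
  -- at a unit.
  have key : ∀ (n : ℕ) (x : G), x ∈ S.W → x⁻¹ * S.b⁻¹ ^ n ∈ S.W → x ∈ S.E := by
    intro n
    induction n with
    | zero => exact fun x hx h => U_le_E ⟨hx, by simpa using h⟩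
    | succ n ih =>
      intro x hx h
      by_cases hu : x ∈ S.U
      · exact U_le_E hu
      have h1 : S.b * x ∈ S.W := by
        by_contra h2
        exact hu (mem_U_of_notMem hx h2)
      have h2 := ih _ h1 (by simpa [pow_succ', mul_assoc] using h)
      simpa using S.E.mul_mem (S.E.inv_mem b_mem_E) h2
  obtain ⟨k, hk⟩ := hz
  obtain ⟨l, hl⟩ := hz'
  have h1 := key (l + k) (z * S.b⁻¹ ^ k) hk (by
    have := conj_mem (S.E.pow_mem b_mem_E k) hl
    simpa [mul_assoc, pow_add] using this)
  simpa [mul_assoc] using S.E.mul_mem h1 (S.E.pow_mem b_mem_E k)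

end GradedCone
end GradedExt

/-! ### Generators of the components and why they normalize `W`. -/

namespace GradedExt
namespace GradedCone

variable {G : Type*} [Group G] {S : GradedCone G}

/-- Submonoids of the kernel of `d` containing the cone in degree `0` form a chain. -/
theorem conj_le_or_le {g : G} (hg : ∀ a ∈ S.P, S.d a = 0 → g * a * g⁻¹ ∈ S.W) :
    (∀ a ∈ S.W, g * a * g⁻¹ ∈ S.W) ∨ ∀ a, g * a * g⁻¹ ∈ S.W → a ∈ S.W := by
  by_contra! h
  obtain ⟨⟨x, hx, hgx⟩, y, hgy, hy⟩ := h
  have hdy : S.d y = 0 := by rw [← S.d_conj g, d_of_mem hgy]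
  have hd : S.d (x * y⁻¹) = 0 := by rw [S.d_mul, S.d_inv, d_of_mem hx, hdy]; simp
  rcases S.total (x * y⁻¹) with hp | hp
  · apply hgx
    simpa [mul_assoc] using S.W.mul_mem (hg _ hp hd) hgy
  · apply hy
    have hd' : S.d (x * y⁻¹)⁻¹ = 0 := by rw [S.d_inv, hd, neg_zero]
    simpa [mul_assoc] using S.W.mul_mem (mem_W_of_mem_P hp hd') hx

/-- Every component generates a principal module over `W`. -/
theorem exists_generator (S : GradedCone G) (r : ℚ) : ∃ y ∈ S.P, S.d y = r ∧
    (∀ q ∈ S.P, S.d q = r → q * y⁻¹ ∈ S.W) ∧ S.b * y ∉ S.P := by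
  -- The condition says that `x` is in no `J q`, with `J` the non-units of `W`. If there were no
  -- such `x`, then two successive relations `p ∈ J q`, `q ∈ J q'` give `b p q'⁻¹ ∈ J`, so `b` would
  -- preserve the component of degree `r` and lie in `W`.
  obtain ⟨x, hx, hdx, h⟩ : ∃ x ∈ S.P, S.d x = r ∧
      ∀ q ∈ S.P, S.d q = r → S.b * x * q⁻¹ ∉ S.W := by
    by_contra! h
    refine b_notMem ((S.mem_W _).2 ⟨S.d_b, r, fun p hp hdp => ?_⟩)
    obtain ⟨q, hq, hdq, h1⟩ := h p hp hdp
    obtain ⟨q', hq', hdq', h2⟩ := h q hq hdq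
    have h3 : S.b⁻¹ * (S.b * (S.b * p * q⁻¹) * S.b⁻¹) * (S.b * q * q'⁻¹) ∈ S.P := by
      apply mem_P_of_b_mul_mem
      simpa [mul_assoc] using S.W.mul_mem (conj_mem b_mem_E h1) h2
    simpa [mul_assoc] using S.P.mul_mem h3 hq'
  refine ⟨x, hx, hdx, fun q hq hdq => ?_, fun hb => ?_⟩
  · by_contra hqx
    have hd : S.d (q * x⁻¹) = 0 := by rw [S.d_mul, S.d_inv, hdq, hdx]; simp
    have := b_mul_mem_of_notMem hd hqx
    exact h q hq hdq (by simpa [mul_assoc] using this)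
  · exact h (S.b * x) hb (by rw [S.d_mul, S.d_b, hdx, zero_add]) (by simp [S.W.one_mem])

/-- If `W` is the left order of the component of degree `t`, then this component is generated by
an element which stabilizes `W`. -/
theorem generator_mem_E {x : G} (hx : x ∈ S.P)
    (ht : ∀ a ∈ S.W, ∀ p ∈ S.P, S.d p = S.d x → a * p ∈ S.P) (hbx : S.b * x ∉ S.P) :
    x ∈ S.E := by
  have hWx : ∀ a, a * x ∈ S.P → S.d a = 0 → a ∈ S.W := by
    intro a ha hd
    by_contra h
    apply hbx
    have := ht _ (b_mul_mem_of_notMem hd h) _ ha (by rw [S.d_mul, hd, zero_add])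
    simpa [mul_assoc] using this
  have hxW : ∀ a ∈ S.W, a * x ∈ S.P := fun a ha => ht a ha x hx rfl
  have h1 : ∀ w ∈ S.W, x⁻¹ * w * x ∈ S.W := by
    intro w hw
    -- If the cone has a unit `p` of the opposite degree, then `W` lies in the cone and `x` agrees
    -- with `p⁻¹` up to a unit of `W`. Otherwise `x⁻¹ w x` is shown to preserve the component of
    -- degree `-d x`.
    by_cases hc : ∃ p ∈ S.P, p⁻¹ ∈ S.P ∧ S.d p = -S.d x
    · obtain ⟨p, hp, hp', hd⟩ := hc
      have hWP : ∀ a ∈ S.W, a ∈ S.P := by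
        intro a ha
        have := S.P.mul_mem (ht a ha p⁻¹ hp' (by rw [S.d_inv, hd, neg_neg])) hp
        simpa using this
      have hxp : x * p ∈ S.W :=
        mem_W_of_mem_P (S.P.mul_mem hx hp) (by rw [S.d_mul, hd, add_neg_cancel])
      have hxp' : (x * p)⁻¹ ∈ S.W := by
        refine hWx _ ?_ (by rw [S.d_inv, d_of_mem hxp, neg_zero])
        simpa [mul_assoc] using hp'
      refine mem_W_of_mem_P ?_ ?_
      · have := S.P.mul_mem (S.P.mul_mem hp
          (hWP _ (S.W.mul_mem (S.W.mul_mem hxp' hw) hxp))) hp'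
        simpa [mul_assoc] using this
      · rw [S.d_mul, S.d_mul, S.d_inv, d_of_mem hw]; ring
    · push Not at hc
      refine (S.mem_W _).2 ⟨by rw [S.d_mul, S.d_mul, S.d_inv, d_of_mem hw]; ring, -S.d x,
        fun p hp hd => ?_⟩
      by_contra hn
      have h2 := inv_mem_P hn
      have hdp : S.d (p⁻¹ * x⁻¹) = 0 := by rw [S.d_mul, S.d_inv, S.d_inv, hd]; ring
      have h3 := hWx (p⁻¹ * x⁻¹ * w⁻¹) (by simpa [mul_assoc] using h2)
        (by rw [S.d_mul, hdp, S.d_inv, d_of_mem hw]; simp)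
      have h4 := hxW _ (S.W.mul_mem h3 hw)
      exact hc p hp (by simpa [mul_assoc] using h4) hd
  have h2 : ∀ j, S.b * j ∈ S.W → x⁻¹ * j ∈ S.P := by
    intro j hj
    by_contra hn
    have hn := inv_mem_P hn
    rw [mul_inv_rev, inv_inv] at hn
    have hj' := (S.mem_J j).2 hj
    exact hj'.2 (hWx _ hn (by rw [S.d_inv, d_of_mem hj'.1, neg_zero]))
  have h3 : ∀ w ∈ S.W, x * w * x⁻¹ ∈ S.W := by
    intro w hw
    by_contra hn
    have hbτ : x⁻¹ * S.b * x ∈ S.W := by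
      have h4 := b_mul_mem_of_notMem (by rw [S.d_conj, d_of_mem hw]) hn
      have h5 := S.W.mul_mem (h1 _ h4) hw
      simpa [mul_assoc] using h5
    -- If `x W x⁻¹` is not contained in `W`, then `x⁻¹ b x ∈ W`. This makes `b` preserve the
    -- component of degree `2 d x`, which contradicts `b ∉ W`.
    refine b_notMem ((S.mem_W _).2 ⟨S.d_b, 2 * S.d x, fun p hp hdp => ?_⟩)
    obtain ⟨z, rfl⟩ : ∃ z, p = z * x * x := ⟨p * x⁻¹ * x⁻¹, by simp⟩
    have hdz : S.d z = 0 := by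
      rw [S.d_mul, S.d_mul] at hdp
      linarith
    have hz : x⁻¹ * z * x ∈ S.W := by
      by_contra hz
      have hdz' : S.d (x⁻¹ * z * x) = 0 := by rw [S.d_mul, S.d_mul, S.d_inv, hdz]; ring
      have h4 := S.W.mul_mem (b_mul_mem_of_notMem hdz' hz) (S.W.mul_mem hbτ hbτ)
      have h5 := h2 (x⁻¹ * z⁻¹ * S.b * S.b * x) (by simpa [mul_assoc] using h4)
      have h6 := h2 S.b⁻¹ (by simp [S.W.one_mem])
      have h7 := S.P.mul_mem (S.P.mul_mem hp h5) h6
      exact b_notMem (mem_W_of_mem_P (by simpa [mul_assoc] using h7) S.d_b)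
    have h4 := S.P.mul_mem hx (hxW _ (S.W.mul_mem hbτ hz))
    simpa [mul_assoc] using h4
  intro a
  refine ⟨h3 a, fun h => ?_⟩
  simpa [mul_assoc] using h1 _ h

theorem conj_pow_mem {g : G} (hg : ∀ a ∈ S.W, g * a * g⁻¹ ∈ S.W) (n : ℕ) :
    ∀ a ∈ S.W, g ^ n * a * (g ^ n)⁻¹ ∈ S.W := by
  induction n with
  | zero => simp
  | succ n ih =>
    intro a ha
    have := hg _ (ih a ha)
    rw [pow_succ']
    simpa only [mul_assoc, mul_inv_rev] using this

/-- The element is the product of the conjugates `g^k b g^{-k}` for `k < n`; all but `b` itself lie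
in `W`. -/
theorem mul_pow_mul_inv_mem_O {g : G} (hg : ∀ a ∈ S.W, g * a * g⁻¹ ∈ S.W)
    (hb : g * S.b * g⁻¹ ∈ S.W) (n : ℕ) : (S.b * g) ^ n * (g ^ n)⁻¹ ∈ S.O := by
  have hb' : ∀ k : ℕ, g ^ k * S.b * (g ^ k)⁻¹ ∈ S.O := by
    intro k
    cases k with
    | zero => simpa using b_mem_O
    | succ k =>
      apply W_le_O
      have := conj_pow_mem hg k _ hb
      rw [pow_succ]
      simpa only [mul_assoc, mul_inv_rev] using this
  induction n with
  | zero => simp [S.O.one_mem]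
  | succ n ih =>
    have := S.O.mul_mem ih (hb' n)
    rw [pow_succ, pow_succ]
    simpa [mul_assoc] using this

theorem inv_mul_mul_pow_mem_W {g : G} (hg : ∀ a ∈ S.W, g⁻¹ * a * g ∈ S.W)
    (hb : g⁻¹ * S.b * g ∈ S.W) (n : ℕ) : (g ^ n)⁻¹ * (S.b * g) ^ n ∈ S.W := by
  have hg' : ∀ a ∈ S.W, (g ^ n)⁻¹ * a * g ^ n ∈ S.W := by
    have := conj_pow_mem (S := S) (g := g⁻¹) (by simpa using hg) n
    simpa using this
  induction n with
  | zero => simp [S.W.one_mem]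
  | succ n ih =>
    have hg'' : ∀ a ∈ S.W, (g ^ n)⁻¹ * a * g ^ n ∈ S.W := by
      have := conj_pow_mem (S := S) (g := g⁻¹) (by simpa using hg) n
      simpa using this
    have := S.W.mul_mem (hg'' _ hb) (ih hg'')
    rw [pow_succ', pow_succ']
    simpa [mul_assoc] using this

/-- Since `(b x)⁻¹` lies in the cone, multiplying by it lowers the degree by `d x` at the cost of
one factor `b`, which `O` absorbs. -/
theorem mul_pow_inv_mem_O {x : G} (hxE : x ∈ S.E) (hbx : S.b * x ∉ S.P) (n : ℕ) :
    ∀ q ∈ S.P, S.d q = n * S.d x → q * (x ^ n)⁻¹ ∈ S.O := by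
  have hx' := inv_mem_P hbx
  induction n with
  | zero =>
    intro q hq hd
    simpa using W_le_O (mem_W_of_mem_P hq (by simpa using hd))
  | succ n ih =>
    intro q hq hd
    have h1 := ih _ (S.P.mul_mem hq hx') (by
      rw [S.d_mul, S.d_inv, S.d_mul, S.d_b, hd]
      push_cast
      ring)
    have h2 := S.O.mul_mem h1 (conj_mem_O (S.E.pow_mem hxE n) b_mem_O)
    rw [pow_succ]
    simpa [mul_assoc] using h2

theorem mul_zpow_inv_mem_O {x : G} (hx : x ∈ S.P) (hxE : x ∈ S.E) (hbx : S.b * x ∉ S.P) (n : ℤ) :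
    ∀ q ∈ S.P, S.d q = n * S.d x → q * (x ^ n)⁻¹ ∈ S.O := by
  intro q hq hd
  obtain ⟨n, rfl | rfl⟩ := n.eq_nat_or_neg
  · simpa using mul_pow_inv_mem_O hxE hbx n q hq (by simpa using hd)
  · have := S.P.mul_mem hq (S.P.pow_mem hx n)
    apply W_le_O
    simpa using mem_W_of_mem_P this (by rw [S.d_mul, hd, S.d_pow]; push_cast; ring)

theorem mem_E_of_pow {g : G} {n : ℕ} (hn : 0 < n) (hg : ∀ a ∈ S.W, g * a * g⁻¹ ∈ S.W)
    (h : g ^ n ∈ S.E) : g ∈ S.E := by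
  obtain ⟨k, rfl⟩ : ∃ k, n = k + 1 := ⟨n - 1, by omega⟩
  intro a
  refine ⟨hg a, fun ha => (h a).2 ?_⟩
  have := conj_pow_mem hg k _ ha
  rw [pow_succ]
  simpa only [mul_assoc, mul_inv_rev] using this

/-- Any `a ∉ W` of degree zero satisfies `b ∈ W a`. Hence a conjugation preserving `W` that brings
such an `a` into `W` also brings `b` into `W`. -/
theorem mem_E_of_notMem {g : G} (hg : ∀ a ∈ S.W, g * a * g⁻¹ ∈ S.W)
    (hb : g * S.b * g⁻¹ ∉ S.W) : g ∈ S.E := by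
  intro a
  refine ⟨hg a, fun ha => ?_⟩
  by_contra hn
  have hd : S.d a = 0 := by rw [← S.d_conj g, d_of_mem ha]
  have := S.W.mul_mem (hg _ (b_mul_mem_of_notMem hd hn)) ha
  exact hb (by simpa [mul_assoc] using this)

/-- A generator of a component whose degree is commensurable with that of `x` stabilizes `W`. -/
theorem mem_E_of_commensurable {x y : G} (hx : x ∈ S.P) (hxE : x ∈ S.E) (hbx : S.b * x ∉ S.P)
    (hy : y ∈ S.P) (hgen : ∀ q ∈ S.P, S.d q = S.d y → q * y⁻¹ ∈ S.W) (hby : S.b * y ∉ S.P)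
    {n : ℕ} {m : ℤ} (hn : 0 < n) (hnm : n * S.d y = m * S.d x) : y ∈ S.E := by
  have hmE : x ^ m ∈ S.E := S.E.zpow_mem hxE m
  have h1 : y ^ n * (x ^ m)⁻¹ ∈ S.O :=
    mul_zpow_inv_mem_O hx hxE hbx m _ (S.P.pow_mem hy n) (by rw [S.d_pow, hnm])
  have h2 : x ^ m * ((S.b * y)⁻¹) ^ n ∈ S.O := by
    have := mul_zpow_inv_mem_O hx hxE hbx (-m) _ (S.P.pow_mem (inv_mem_P hby) n) (by
      rw [S.d_pow, S.d_inv, S.d_mul, S.d_b, zero_add]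
      push_cast
      linarith)
    rw [zpow_neg, inv_inv] at this
    simpa [mul_assoc] using conj_mem_O hmE this
  rw [inv_pow] at h2
  -- So far `y ^ n (x ^ m)⁻¹ ∈ O` and `x ^ m (b y)^{-n} ∈ O`. Replacing `(b y) ^ n` by `y ^ n` in
  -- the second would make `y ^ n (x ^ m)⁻¹` a unit of `O`; this is possible when conjugation keeps
  -- `b` in `W`, and otherwise `y` normalizes `W` directly.
  have hpow : x ^ m * (y ^ n)⁻¹ ∈ S.O → y ^ n ∈ S.E := by
    intro h
    have := S.E.mul_mem (mem_E_of_mem_O h1 (by simpa using h)) hmE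
    simpa using this
  have hconj : ∀ a ∈ S.P, S.d a = 0 → y * a * y⁻¹ ∈ S.W := fun a ha hd =>
    hgen _ (S.P.mul_mem hy ha) (by rw [S.d_mul, hd, add_zero])
  rcases conj_le_or_le hconj with hτ | hτ
  · by_cases hb : y * S.b * y⁻¹ ∈ S.W
    · refine mem_E_of_pow hn hτ (hpow ?_)
      have h3 := S.O.mul_mem h2 (mul_pow_mul_inv_mem_O hτ hb n)
      simpa [mul_assoc] using h3
    · exact mem_E_of_notMem hτ hb
  · have hτ' : ∀ a ∈ S.W, y⁻¹ * a * y ∈ S.W := fun a ha => hτ _ (by simpa [mul_assoc] using ha)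
    refine S.E.inv_mem_iff.1 ?_
    by_cases hb : y⁻¹ * S.b * y ∈ S.W
    · have h3 := S.O.mul_mem (conj_mem_O hmE (W_le_O (inv_mul_mul_pow_mem_W hτ' hb n))) h2
      refine mem_E_of_pow hn (by simpa using hτ') ?_
      rw [inv_pow]
      exact S.E.inv_mem (hpow (by simpa [mul_assoc] using h3))
    · exact mem_E_of_notMem (by simpa using hτ') (by simpa using hb)

/-- If `W` is the left order of some component, then all components are generated, as modules
over `W`, by elements stabilizing `W`. -/
theorem exists_generator_mem_E (S : GradedCone G)
    (ht : ∃ t, ∀ a ∈ S.W, ∀ p ∈ S.P, S.d p = t → a * p ∈ S.P) (r : ℚ) :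
    ∃ y ∈ S.P, S.d y = r ∧ (∀ q ∈ S.P, S.d q = r → q * y⁻¹ ∈ S.W) ∧ S.b * y ∉ S.P ∧
      y ∈ S.E := by
  -- Commensurability with `t` needs `t ≠ 0`. If `t = 0`, then `W` lies in the cone and preserves
  -- every component, so any other degree serves.
  obtain ⟨t, ht0, ht⟩ : ∃ t, t ≠ 0 ∧ ∀ a ∈ S.W, ∀ p ∈ S.P, S.d p = t → a * p ∈ S.P := by
    obtain ⟨t, ht⟩ := ht
    rcases eq_or_ne t 0 with rfl | h
    · refine ⟨1, one_ne_zero, fun a ha p hp _ => S.P.mul_mem ?_ hp⟩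
      simpa using ht a ha 1 S.P.one_mem S.d_one
    · exact ⟨t, h, ht⟩
  obtain ⟨x, hx, rfl, -, hbx⟩ := S.exists_generator t
  have hxE := generator_mem_E hx ht hbx
  obtain ⟨y, hy, rfl, hgen, hby⟩ := S.exists_generator r
  refine ⟨y, hy, rfl, hgen, hby, ?_⟩
  refine mem_E_of_commensurable hx hxE hbx hy hgen hby (n := (S.d y / S.d x).den)
    (m := (S.d y / S.d x).num) (Rat.den_pos _) ?_
  have h := Rat.num_div_den (S.d y / S.d x)
  have hd : ((S.d y / S.d x).den : ℚ) ≠ 0 := by exact_mod_cast (S.d y / S.d x).den_nz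
  rw [div_eq_div_iff hd ht0] at h
  linarith

end GradedCone
end GradedExt

/-! ### The central extension inside `E / U`. -/

namespace GradedExt

/-- A choice of generators of the components. -/
structure GeneratedCone (G : Type*) [Group G] extends GradedCone G where
  y : ℚ → G
  y_mem : ∀ r, y r ∈ P
  d_y : ∀ r, d (y r) = r
  gen : ∀ q ∈ P, q * (y (d q))⁻¹ ∈ W
  b_mul_y : ∀ r, b * y r ∉ P
  y_mem_E : ∀ r, y r ∈ toGradedCone.E
  y_zero : y 0 = 1

namespace GradedCone
variable {G : Type*} [Group G]

theorem exists_generatedCone (S : GradedCone G)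
    (ht : ∃ t, ∀ a ∈ S.W, ∀ p ∈ S.P, S.d p = t → a * p ∈ S.P) :
    ∃ T : GeneratedCone G, T.toGradedCone = S := by
  choose y h1 h2 h3 h4 h5 using S.exists_generator_mem_E ht
  refine ⟨{ S with
    y := fun r => if r = 0 then 1 else y r
    y_mem := fun r => ?_
    d_y := fun r => ?_
    gen := fun q hq => ?_
    b_mul_y := fun r => ?_
    y_mem_E := fun r => ?_
    y_zero := if_pos rfl }, rfl⟩
  · split_ifs
    exacts [S.P.one_mem, h1 r]
  · split_ifs with h
    exacts [S.d_one.trans h.symm, h2 r]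
  · split_ifs with h
    · simpa using mem_W_of_mem_P hq h
    · exact h3 _ q hq rfl
  · split_ifs
    · exact fun h => b_notMem (mem_W_of_mem_P (by simpa using h) S.d_b)
    · exact h4 r
  · split_ifs
    exacts [S.E.one_mem, h5 r]

/-- `E / U`. -/
abbrev Quot (S : GradedCone G) : Type _ := S.E ⧸ S.U.subgroupOf S.E

instance (S : GradedCone G) : (S.U.subgroupOf S.E).Normal :=
  ⟨fun _ hu g => conj_mem_U g.2 hu⟩

/-- The projection `E → E / U`. -/
def proj (S : GradedCone G) : S.E →* S.Quot := QuotientGroup.mk' _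

theorem proj_eq_iff {S : GradedCone G} {g h : S.E} :
    S.proj g = S.proj h ↔ (g : G) * (h : G)⁻¹ ∈ S.U := by
  rw [← mul_inv_eq_one, ← map_inv, ← map_mul]
  exact QuotientGroup.eq_one_iff _

theorem b_zpow_mem_U {S : GradedCone G} {n : ℤ} (h : S.b ^ n ∈ S.U) : n = 0 := by
  have key : ∀ n : ℕ, S.b ^ n ∈ S.U → n = 0 := by
    intro n hn
    by_contra h0
    obtain ⟨k, rfl⟩ := Nat.exists_eq_succ_of_ne_zero h0
    have := S.W.mul_mem hn.1 (S.W.pow_mem b_inv_mem k)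
    rw [Nat.succ_eq_add_one, pow_succ'] at this
    exact b_notMem (by simpa using this)
  obtain ⟨n, rfl | rfl⟩ := n.eq_nat_or_neg
  · simpa using key n (by simpa using h)
  · rw [zpow_neg, S.U.inv_mem_iff] at h
    simpa using key n (by simpa using h)

end GradedCone

namespace GeneratedCone

open GradedCone

variable {G : Type*} [Group G] (T : GeneratedCone G)

/-- The product `y_r y_s` lies in `W y_{r+s}`. Multiplying `y_{r+s}` by `(b y_s)⁻¹`, which is in the
cone, shows that `y_{r+s}` lies in `W b y_r y_s`. Nothing lies strictly between, as every non-unit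
of `W` is in `b⁻¹ W`. -/
theorem mul_mem_or (r s : ℚ) : T.y (r + s) * (T.y r * T.y s)⁻¹ ∈ T.U ∨
    T.y (r + s) * (T.b * (T.y r * T.y s))⁻¹ ∈ T.U := by
  have hd : T.d (T.y r * T.y s) = r + s := by rw [T.d_mul, T.d_y, T.d_y]
  have h1 := T.gen _ (T.P.mul_mem (T.y_mem r) (T.y_mem s))
  rw [hd] at h1
  have h2 := inv_mem_P (T.b_mul_y s)
  have h3 := T.gen _ (T.P.mul_mem (T.y_mem (r + s)) h2)
  have hd3 : T.d (T.y (r + s) * (T.b * T.y s)⁻¹) = r := by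
    rw [T.d_mul, T.d_inv, T.d_mul, T.d_b, T.d_y, T.d_y]
    ring
  rw [hd3] at h3
  have h4 : T.y (r + s) * (T.y r * T.y s)⁻¹ * T.b⁻¹ ∈ T.W := by
    have h5 := T.W.mul_mem h3 (commutator_mem_U (T.y_mem_E r)).2
    simpa [mul_assoc] using h5
  by_cases hu : T.y r * T.y s * (T.y (r + s))⁻¹ ∈ T.U
  · left
    simpa [mul_assoc] using T.U.inv_mem hu
  · right
    refine ⟨by simpa [mul_assoc] using h4, ?_⟩
    have h5 : T.b * (T.y r * T.y s * (T.y (r + s))⁻¹) ∈ T.W := by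
      by_contra h6
      exact hu (mem_U_of_notMem h1 h6)
    simpa [mul_assoc] using h5

/-- The element `b` of the stabilizer. -/
def bE : T.E := ⟨T.b, b_mem_E⟩

/-- The chosen generators as elements of the stabilizer. -/
def yE (r : ℚ) : T.E := ⟨T.y r, T.y_mem_E r⟩

/-- The central extension of `ℚ` by the powers of `b`, modulo the units of `W`. -/
def extension : CentralSection T.Quot where
  z := T.proj T.bE
  B r := T.proj (T.yE r)
  central g := by
    obtain ⟨e, rfl⟩ := QuotientGroup.mk'_surjective _ g
    change T.proj _ * T.proj _ = T.proj _ * T.proj _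
    rw [← map_mul, ← map_mul, proj_eq_iff]
    simpa [mul_assoc, bE] using commutator_mem_U e.2
  zpow_inj n h := by
    rw [← map_zpow, ← map_one T.proj, proj_eq_iff] at h
    exact b_zpow_mem_U (by simpa [bE] using h)
  B_zero := by
    rw [← map_one T.proj, proj_eq_iff]
    simp [yE, T.y_zero, T.U.one_mem]
  mul r s := by
    rw [← map_mul, ← map_mul, proj_eq_iff, proj_eq_iff]
    exact T.mul_mem_or r s

end GeneratedCone
end GradedExt

/-! ### Degrees `r` with `y_r y_{-r}` in `U`, and those without. -/

namespace GradedExt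

namespace CentralSection

variable {Γ : Type*} [Group Γ] (S : CentralSection Γ)

/-- Now the step function vanishes at `1` and at `-1`, so superadditivity makes it nonnegative
everywhere, while opposite values have sum at most zero. -/
theorem step_eq_zero {s : ℚ} (h : S.B s * S.B (-s) = 1) (i : ℤ) : S.step s i = 0 := by
  have hg := S.isGradedMap_step s
  have h1 : S.step s (-1) = 0 := by
    apply S.step_unique
    rw [zpow_zero, one_mul, zpow_neg_one]
    simpa using eq_inv_of_mul_eq_one_right h
  have hneg : ∀ n : ℕ, 0 ≤ S.step s (-n) := by
    intro n
    induction n with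
    | zero => simp [S.step_zero]
    | succ n ih =>
      have := hg.2.1 (-n) (-1)
      push_cast
      rw [neg_add]
      omega
  have key : ∀ n : ℕ, S.step s n = 0 ∧ S.step s (-n) = 0 := by
    intro n
    have h2 := hg.2.1 n (-n)
    rw [add_neg_cancel, S.step_zero] at h2
    have := hneg n
    have := S.step_nonneg s n
    omega
  obtain ⟨n, rfl | rfl⟩ := i.eq_nat_or_neg
  exacts [(key n).1, (key n).2]

theorem B_mul {s : ℚ} (h : S.B s * S.B (-s) = 1) (i : ℤ) : S.B (i * s) = S.B s ^ i := by
  rw [S.step_spec, S.step_eq_zero h, zpow_zero, one_mul]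

theorem B_add_of_forall (h : ∀ l : ℕ, 0 < l → S.B (1 / l) * S.B (-(1 / l)) = 1) (r s : ℚ) :
    S.B (r + s) = S.B r * S.B s := by
  have hl : 0 < r.den * s.den := mul_pos (Rat.den_pos _) (Rat.den_pos _)
  have h1 := h _ hl
  have hrd : (r.den : ℚ) ≠ 0 := by exact_mod_cast r.den_nz
  have hsd : (s.den : ℚ) ≠ 0 := by exact_mod_cast s.den_nz
  have hr : r = ((r.num * s.den : ℤ) : ℚ) * (1 / (r.den * s.den : ℕ)) := by
    conv_lhs => rw [← Rat.num_div_den r]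
    push_cast
    field_simp
  have hs : s = ((s.num * r.den : ℤ) : ℚ) * (1 / (r.den * s.den : ℕ)) := by
    conv_lhs => rw [← Rat.num_div_den s]
    push_cast
    field_simp
  have h2 := S.B_mul h1 (r.num * s.den)
  have h3 := S.B_mul h1 (s.num * r.den)
  have h4 := S.B_mul h1 (r.num * s.den + s.num * r.den)
  rw [← hr] at h2
  rw [← hs] at h3
  rw [Int.cast_add, add_mul, ← hr, ← hs] at h4
  rw [h2, h3, h4, zpow_add]

theorem mul_neg_ne_one_of_mul {s : ℚ} (n : ℕ) (h : S.B (n * s) * S.B (-(n * s)) ≠ 1) :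
    S.B s * S.B (-s) ≠ 1 := by
  intro h1
  apply h
  have h2 := S.B_mul h1 n
  have h3 := S.B_mul h1 (-n)
  rw [Int.cast_natCast] at h2
  rw [Int.cast_neg, Int.cast_natCast, neg_mul] at h3
  rw [h2, h3, ← zpow_add, add_neg_cancel, zpow_zero]

end CentralSection

namespace GeneratedCone

open GradedCone

variable {G : Type*} [Group G] (T : GeneratedCone G)

theorem B_mul_B_eq_one_iff {r s : ℚ} :
    T.extension.B r * T.extension.B s = 1 ↔ T.y r * T.y s ∈ T.U := by
  change T.proj (T.yE r) * T.proj (T.yE s) = 1 ↔ _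
  rw [← map_mul, ← map_one T.proj, proj_eq_iff]
  simp [yE]

theorem B_eq_zpow_mul_iff {r s : ℚ} {g i : ℤ} :
    T.extension.B r = T.extension.z ^ g * T.extension.B s ^ i ↔
      T.y r * (T.b ^ g * T.y s ^ i)⁻¹ ∈ T.U := by
  change T.proj (T.yE r) = T.proj T.bE ^ g * T.proj (T.yE s) ^ i ↔ _
  rw [← map_zpow, ← map_zpow, ← map_mul, proj_eq_iff]
  simp [yE, bE]

variable {T}

/-- If the extension splits on the nose then products of components are components. -/
theorem exists_factorization (ht : ∃ t, ∀ a ∈ T.W, ∀ p ∈ T.P, T.d p = t → a * p ∈ T.P)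
    (h : ∀ l : ℕ, 0 < l → T.y (1 / l) * T.y (-(1 / l)) ∈ T.U) {r s : ℚ} {q : G} (hq : q ∈ T.P)
    (hd : T.d q = r + s) : ∃ p ∈ T.P, ∃ p' ∈ T.P, T.d p = r ∧ T.d p' = s ∧ q = p * p' := by
  have hB := T.extension.B_add_of_forall fun l hl => T.B_mul_B_eq_one_iff.2 (h l hl)
  have hU : ∀ r s, T.y (r + s) * (T.y r * T.y s)⁻¹ ∈ T.U := by
    intro r s
    have := hB r s
    change T.proj (T.yE _) = T.proj (T.yE r) * T.proj (T.yE s) at this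
    rwa [← map_mul, proj_eq_iff] at this
  have hWP : ∀ w ∈ T.W, w ∈ T.P := by
    obtain ⟨t, ht⟩ := ht
    intro w hw
    have h1 := hU t (-t)
    rw [add_neg_cancel, T.y_zero, one_mul] at h1
    have h2 := T.P.mul_mem (ht _ (T.W.mul_mem hw h1.1) _ (T.y_mem t) (T.d_y t)) (T.y_mem (-t))
    simpa [mul_assoc] using h2
  have h1 := T.gen q hq
  rw [hd] at h1
  have h2 := T.W.mul_mem h1 (hU r s).1
  refine ⟨_, T.P.mul_mem (hWP _ h2) (T.y_mem r), T.y s, T.y_mem s, ?_, T.d_y s, ?_⟩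
  · rw [T.d_mul, d_of_mem h2, T.d_y, zero_add]
  · simp [mul_assoc]

theorem b_mul_mem_U {r : ℚ} (h : T.y r * T.y (-r) ∉ T.U) : T.b * (T.y r * T.y (-r)) ∈ T.U := by
  rcases T.mul_mem_or r (-r) with h1 | h1 <;>
    rw [add_neg_cancel, T.y_zero, one_mul, T.U.inv_mem_iff] at h1
  exacts [absurd h1 h, h1]

/-- Otherwise `(w y_r)⁻¹ ∈ W y_{-r}`; together with `b y_r y_{-r} ∈ U` this would put `b` in `W`.
Consequently `A_r = W y_r`, not only `W A_r = W y_r`. -/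
theorem W_mul_y_mem {r : ℚ} (h : T.y r * T.y (-r) ∉ T.U) {w : G} (hw : w ∈ T.W) :
    w * T.y r ∈ T.P := by
  by_contra hn
  have h1 := T.gen _ (inv_mem_P hn)
  rw [T.d_inv, T.d_mul, d_of_mem hw, T.d_y, zero_add] at h1
  have h2 := conj_mem (T.y_mem_E r) h1
  have h3 := (b_mul_mem_U h).1
  have h4 := T.W.mul_mem h3 (T.W.mul_mem hw h2)
  exact b_notMem (S := T.toGradedCone) (by simpa [mul_assoc] using h4)

/-- The source of the identity for `A_{-r}` in Type (e): membership of `q` amounts to `q y_r` being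
a non-unit of `W`. -/
theorem mem_P_iff_of_neg {r : ℚ} (h : T.y r * T.y (-r) ∉ T.U) {q : G} (hd : T.d q = -r) :
    q ∈ T.P ↔ T.b * (q * T.y r) ∈ T.W := by
  constructor
  · intro hq
    have h1 := T.gen q hq
    rw [hd] at h1
    have h3 := b_mul_mem_U h
    have h4 := conj_mem b_mem_E h1
    have h5 := (conj_mem_U (T.E.inv_mem (T.y_mem_E r)) h3).1
    have h6 := (commutator_mem_U (T.E.inv_mem (T.y_mem_E r))).1
    have h7 := T.W.mul_mem h4 (T.W.mul_mem h6 h5)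
    simpa [mul_assoc] using h7
  · intro hb
    obtain ⟨h1, h2⟩ := (T.mem_J _).2 hb
    by_contra hn
    have h3 := T.gen _ (inv_mem_P hn)
    rw [T.d_inv, hd, neg_neg] at h3
    have h4 := conj_mem (T.E.inv_mem (T.y_mem_E r)) h3
    exact h2 (by simpa [mul_assoc] using h4)

/-- If `A_r = W a` and `A_{-r} = J a⁻¹`, then the generators of `A_r` and `A_{-r}` are not
inverse to each other. -/
theorem mul_neg_notMem_U {r : ℚ} {a : G} (ha : a ∈ T.P) (hda : T.d a = r)
    (h1 : ∀ q ∈ T.P, T.d q = r → q * a⁻¹ ∈ T.W)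
    (h2 : ∀ q ∈ T.P, T.d q = -r → T.b * (q * a) ∈ T.W) : T.y r * T.y (-r) ∉ T.U := by
  intro hu
  have h3 := h1 _ (T.y_mem r) (T.d_y r)
  have h4 := T.gen a ha
  rw [hda] at h4
  have h5 : a * (T.y r)⁻¹ ∈ T.U := ⟨h4, by simpa using h3⟩
  have h6 := h2 _ (T.y_mem (-r)) (T.d_y (-r))
  have h8 := conj_mem_U (T.E.inv_mem (T.y_mem_E r)) hu
  have h9 := conj_mem_U (T.E.inv_mem (T.y_mem_E r)) h5
  have h10 := T.U.mul_mem h8 h9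
  refine ((T.mem_J _).2 h6).2 ?_
  have h11 := h10.2
  simpa [mul_assoc] using h11

end GeneratedCone
end GradedExt

/-! ### The radical of a total valuation ring. -/

namespace GradedExt

section Radical

variable {F : Type*} [DivisionRing F] {W : Subring F}

theorem mem_radical_iff_forall {x : F} (hx : x ∈ W) :
    x ∈ radical W ↔ ∀ y ∈ W, ∃ z ∈ W, z * (y * x + 1) = 1 := by
  have h1 : x ∈ radical W ↔ (⟨x, hx⟩ : W) ∈ Ring.jacobson W := by
    constructor
    · rintro ⟨y, hy, rfl⟩
      exact hy
    · exact fun h => ⟨_, h, rfl⟩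
  rw [h1, ← Ideal.jacobson_bot, Ideal.mem_jacobson_iff]
  constructor
  · intro h y hy
    obtain ⟨z, hz⟩ := h ⟨y, hy⟩
    refine ⟨z, z.2, ?_⟩
    have : z * y * x + z - 1 = (0 : F) := congrArg (Subtype.val) ((Submodule.mem_bot W).1 hz)
    rw [mul_add, mul_one, ← mul_assoc]
    exact sub_eq_zero.1 this
  · intro h y
    obtain ⟨z, hz, h2⟩ := h y y.2
    refine ⟨⟨z, hz⟩, (Submodule.mem_bot W).2 (Subtype.ext ?_)⟩
    change z * y * x + z - 1 = (0 : F)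
    rw [mul_add, mul_one, ← mul_assoc] at h2
    exact sub_eq_zero.2 h2

theorem radical_subset {x : F} (hx : x ∈ radical W) : x ∈ W := by
  obtain ⟨y, -, rfl⟩ := hx
  exact y.2

theorem zero_mem_radical : (0 : F) ∈ radical W := ⟨0, Submodule.zero_mem _, rfl⟩

/-- The radical of a total valuation ring consists of its non-units. -/
theorem mem_radical_iff (hW : IsTotalValuationRing W) {x : F} (hx : x ≠ 0) :
    x ∈ radical W ↔ x ∈ W ∧ x⁻¹ ∉ W := by
  constructor
  · intro h
    refine ⟨radical_subset h, fun hi => ?_⟩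
    obtain ⟨z, -, hz⟩ := (mem_radical_iff_forall (radical_subset h)).1 h (-x⁻¹) (W.neg_mem hi)
    simp [hx] at hz
  · rintro ⟨h1, h2⟩
    rw [mem_radical_iff_forall h1]
    intro y hy
    rcases eq_or_ne y 0 with rfl | hy0
    · exact ⟨1, W.one_mem, by simp⟩
    have hn : (y * x)⁻¹ ∉ W := by
      intro h
      rw [mul_inv_rev] at h
      exact h2 (by simpa [mul_assoc, hy0] using W.mul_mem h hy)
    have hyx : y * x ≠ 0 := mul_ne_zero hy0 hx
    have hv : y * x + 1 ≠ 0 := by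
      intro h
      rw [eq_neg_of_add_eq_zero_left h] at hn
      exact hn (by simp [W.one_mem])
    refine ⟨(y * x + 1)⁻¹, ?_, inv_mul_cancel₀ hv⟩
    -- The element tested is `1 + (y x)⁻¹`, which is not in `W`. Hence its inverse `y x (y x + 1)⁻¹`
    -- is, and `(y x + 1)⁻¹` is one minus that.
    rcases hW _ (mul_ne_zero hv (inv_ne_zero hyx)) with h | h
    · exfalso
      rw [add_mul, mul_inv_cancel₀ hyx, one_mul] at h
      exact hn (by simpa using W.sub_mem h W.one_mem)
    · rw [mul_inv_rev, inv_inv] at h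
      have h3 : (y * x + 1)⁻¹ = 1 - (y * x) * (y * x + 1)⁻¹ := by
        rw [eq_sub_iff_add_eq, ← one_add_mul, add_comm, mul_inv_cancel₀ hv]
      rw [h3]
      exact W.sub_mem W.one_mem h

end Radical

/-! ### The group of homogeneous units and the cone of a graded extension. -/

variable {K : Type*} [DivisionRing K] [MulSemiringAction (Multiplicative ℚ) K]

theorem sigma_zero (x : K) : sigma K 0 x = x := by simp [sigma]

theorem sigma_add (r s : ℚ) (x : K) : sigma K (r + s) x = sigma K r (sigma K s x) := by
  simp [sigma]

theorem sigma_sigma_neg (r : ℚ) (x : K) : sigma K r (sigma K (-r) x) = x := by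
  rw [← sigma_add, add_neg_cancel, sigma_zero]

/-- The action of `ℚ` on the units of `K`. -/
def unitAction (K : Type*) [DivisionRing K] [MulSemiringAction (Multiplicative ℚ) K] :
    Multiplicative ℚ →* MulAut Kˣ where
  toFun g := Units.mapEquiv (sigma K g.toAdd).toMulEquiv
  map_one' := by ext x; exact sigma_zero _
  map_mul' g h := by ext x; exact sigma_add _ _ _

/-- The group of homogeneous units `a X^r` of `K[ℚ, σ]`. -/
abbrev HomUnits (K : Type*) [DivisionRing K] [MulSemiringAction (Multiplicative ℚ) K] : Type _ :=
  Kˣ ⋊[unitAction K] Multiplicative ℚ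

namespace HomUnits

/-- The coefficient of a homogeneous unit. -/
def coef (g : HomUnits K) : K := (g.left : K)

/-- The degree of a homogeneous unit. -/
def deg (g : HomUnits K) : ℚ := g.right.toAdd

/-- The homogeneous unit `a X^r`. -/
def mk (r : ℚ) (a : K) (ha : a ≠ 0) : HomUnits K := ⟨Units.mk0 a ha, Multiplicative.ofAdd r⟩

@[simp] theorem coef_mk (r : ℚ) (a : K) (ha : a ≠ 0) : coef (mk r a ha) = a := rfl

@[simp] theorem deg_mk (r : ℚ) (a : K) (ha : a ≠ 0) : deg (mk r a ha) = r := rfl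

theorem coef_ne_zero (g : HomUnits K) : coef g ≠ 0 := g.left.ne_zero

@[simp] theorem deg_mul (g h : HomUnits K) : deg (g * h) = deg g + deg h := rfl

@[simp] theorem deg_inv (g : HomUnits K) : deg g⁻¹ = -deg g := rfl

@[simp] theorem deg_one : deg (1 : HomUnits K) = 0 := rfl

@[simp] theorem coef_one : coef (1 : HomUnits K) = 1 := rfl

theorem coef_mul (g h : HomUnits K) : coef (g * h) = coef g * sigma K (deg g) (coef h) := rfl

theorem coef_inv (g : HomUnits K) : coef g⁻¹ = sigma K (-deg g) (coef g)⁻¹ := by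
  have h : coef g⁻¹ = sigma K (-deg g) ((g.left⁻¹ : Kˣ) : K) := rfl
  rw [h, Units.val_inv_eq_inv_val]
  rfl

theorem coef_mul_of_deg_zero {g h : HomUnits K} (hg : deg g = 0) :
    coef (g * h) = coef g * coef h := by
  rw [coef_mul, hg, sigma_zero]

theorem coef_inv_of_deg_zero {g : HomUnits K} (hg : deg g = 0) : coef g⁻¹ = (coef g)⁻¹ := by
  rw [coef_inv, hg, neg_zero, sigma_zero]

theorem coef_conj (g a : HomUnits K) (ha : deg a = 0) :
    coef (g * a * g⁻¹) = coef g * sigma K (deg g) (coef a) * (coef g)⁻¹ := by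
  rw [coef_mul, coef_mul, coef_inv, deg_mul, ha, add_zero, sigma_sigma_neg]

theorem coef_mul_inv {g h : HomUnits K} (hd : deg g = deg h) :
    coef (g * h⁻¹) = coef g * (coef h)⁻¹ := by
  rw [coef_mul, coef_inv, hd, sigma_sigma_neg]

/-- A homogeneous unit as an element of the skew group ring. -/
noncomputable def toRing (g : HomUnits K) : SkewGroupRing K := hom (deg g) (coef g)

theorem toRing_mul (g h : HomUnits K) : toRing (g * h) = toRing g * toRing h := by
  rw [toRing, toRing, toRing, hom_mul_hom, deg_mul, coef_mul]

theorem toRing_one : toRing (1 : HomUnits K) = 1 := rfl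

end HomUnits

open HomUnits

variable {V : Subring K} {A : Subring (SkewGroupRing K)}

theorem le_bigW (hA : IsGradedExtension V A) : V ≤ bigW A :=
  (le_leftOrder hA 0).trans (le_iSup (fun r => leftOrder (comp A r)) 0)

theorem isTotalValuationRing_bigW (hV : IsTotalValuationRing V) (hA : IsGradedExtension V A) :
    IsTotalValuationRing (bigW A) :=
  fun k hk => (hV k hk).imp (fun h => le_bigW hA h) fun h => le_bigW hA h

theorem mem_bigW_iff (hV : IsTotalValuationRing V) (hA : IsGradedExtension V A) {a : K} :
    a ∈ bigW A ↔ ∃ r : ℚ, ∀ x ∈ comp A r, a * x ∈ comp A r := by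
  rw [← SetLike.mem_coe, coe_bigW hV hA]
  simp only [Set.mem_iUnion]
  rfl

/-- The cone of a graded extension of a total valuation ring. -/
noncomputable def coneOf (hV : IsTotalValuationRing V) (hA : IsGradedExtension V A) {b : K}
    (hb : b ≠ 0) (hJ : radical (bigW A) = {b⁻¹} * (bigW A : Set K)) : GradedCone (HomUnits K) where
  d := deg
  d_mul := deg_mul
  P :=
    { carrier := {g | toRing g ∈ A}
      mul_mem' := fun {g h} hg hh => by
        change toRing (g * h) ∈ A
        rw [toRing_mul]
        exact A.mul_mem hg hh
      one_mem' := A.one_mem }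
  total g := by
    rcases hA.total (deg g) (coef g) (coef_ne_zero g) with h | ⟨y, hy, h1, h2⟩
    · exact Or.inl h
    · right
      have h3 : toRing g⁻¹ * toRing g = 1 := by rw [← toRing_mul, inv_mul_cancel, toRing_one]
      have h4 : toRing g⁻¹ = y := left_inv_eq_right_inv h3 h1
      change toRing g⁻¹ ∈ A
      rwa [h4]
  W :=
    { carrier := {g | deg g = 0 ∧ coef g ∈ bigW A}
      mul_mem' := fun {g h} hg hh => ⟨by rw [deg_mul, hg.1, hh.1, add_zero], by
        rw [coef_mul_of_deg_zero hg.1]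
        exact (bigW A).mul_mem hg.2 hh.2⟩
      one_mem' := ⟨rfl, (bigW A).one_mem⟩ }
  mem_W a := by
    change (deg a = 0 ∧ coef a ∈ bigW A) ↔ _
    rw [mem_bigW_iff hV hA]
    refine and_congr_right fun ha => exists_congr fun r => ⟨?_, ?_⟩
    · rintro h p hp rfl
      change coef (a * p) ∈ comp A (deg (a * p))
      rw [coef_mul_of_deg_zero ha, deg_mul, ha, zero_add]
      exact h _ hp
    · intro h x hx
      rcases eq_or_ne x 0 with rfl | hx0
      · rw [mul_zero]
        exact (comp A r).zero_mem
      · have h1 : coef (a * mk r x hx0) ∈ comp A (deg (a * mk r x hx0)) :=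
          h (mk r x hx0) hx rfl
        rwa [coef_mul_of_deg_zero ha, deg_mul, ha, zero_add] at h1
  b := mk 0 b hb
  d_b := rfl
  mem_J a := by
    change ((deg a = 0 ∧ coef a ∈ bigW A) ∧ ¬(deg a⁻¹ = 0 ∧ coef a⁻¹ ∈ bigW A)) ↔
      (deg (mk 0 b hb * a) = 0 ∧ coef (mk 0 b hb * a) ∈ bigW A)
    rw [coef_mul_of_deg_zero (deg_mk _ _ _), deg_mul, deg_mk, zero_add, coef_mk, deg_inv,
      neg_eq_zero]
    by_cases ha : deg a = 0
    · rw [coef_inv_of_deg_zero ha]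
      have h1 := mem_radical_iff (isTotalValuationRing_bigW hV hA) (coef_ne_zero a)
      rw [hJ] at h1
      simp only [ha, true_and]
      rw [← h1, Set.singleton_mul, Set.mem_image]
      constructor
      · rintro ⟨w, hw, h⟩
        rw [← h, mul_inv_cancel_left₀ hb]
        exact hw
      · exact fun h => ⟨_, h, inv_mul_cancel_left₀ hb _⟩
    · simp [ha]

end GradedExt

/-! ### Splittings as graded maps. -/

namespace GradedExt

namespace CentralSection

variable {Γ : Type*} [Group Γ] (S : CentralSection Γ) {f : ℚ → ℤ}

/-- `f` splits the extension. -/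
def IsSplitting (f : ℚ → ℤ) : Prop := ∀ r s, S.z ^ (-f (r + s)) * S.B (r + s) =
  (S.z ^ (-f r) * S.B r) * (S.z ^ (-f s) * S.B s)

variable {S}

theorem IsSplitting.zero (hf : S.IsSplitting f) : f 0 = 0 := by
  have h := hf 0 0
  rw [add_zero, left_eq_mul, S.B_zero, mul_one] at h
  have := S.zpow_inj _ h
  omega

/-- Comparing powers of `z` identifies the cocycle with the defect `f (r + s) - f r - f s`. -/
theorem IsSplitting.add (hf : S.IsSplitting f) (r s : ℚ) :
    f (r + s) = f r + f s ∨ f (r + s) = f r + f s + 1 := by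
  obtain ⟨c, h0, h1, hc⟩ := S.exists_cocycle r s
  have h := hf r s
  rw [hc, S.zpow_mul_mul, ← mul_assoc, ← zpow_add] at h
  have := S.zpow_cancel h
  omega

theorem IsSplitting.isGradedMap (hf : S.IsSplitting f) : IsGradedMap f := by
  refine ⟨hf.zero, fun r s => ?_, fun s => ?_⟩
  · rcases hf.add r s with h | h <;> omega
  · have h0 := hf.zero
    rcases hf.add s (-s) with h | h <;> rw [add_neg_cancel] at h <;> omega

theorem IsSplitting.nat_mul (hf : S.IsSplitting f) (s : ℚ) (n : ℕ) :
    S.z ^ (-f (n * s)) * S.B (n * s) = (S.z ^ (-f s) * S.B s) ^ n := by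
  induction n with
  | zero => simp [hf.zero, S.B_zero]
  | succ n ih =>
    rw [pow_succ, ← ih, ← hf, Nat.cast_succ, add_one_mul]

theorem IsSplitting.step_eq (hf : S.IsSplitting f) (s : ℚ) (n : ℕ) :
    S.step s n = f (n * s) - n * f s := by
  apply S.step_unique
  have h := hf.nat_mul s n
  rw [(show Commute (S.z ^ (-f s)) (S.B s) from S.commute_zpow _ _).mul_pow, ← zpow_natCast,
    ← zpow_mul, zpow_neg, inv_mul_eq_iff_eq_mul, ← mul_assoc, ← zpow_add] at h
  rw [Int.cast_natCast, h, zpow_natCast]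
  congr 2
  ring

/-- If `f ≤ -1` at all positive degrees, then the step value `f (p / q) - n p f (1 / (n q))` is at
least `f (p / q) + n p`, which is unbounded in `n`. -/
theorem IsSplitting.exists_nonneg (hf : S.IsSplitting f) {p q : ℕ} (hp : 0 < p) (hq : 0 < q)
    {C : ℤ} (hC : ∀ n : ℕ, 0 < n → S.step (1 / (n * q)) (n * p) ≤ C) :
    ∃ s : ℚ, 0 < s ∧ 0 ≤ f s := by
  by_contra! hneg
  have key : ∀ n : ℕ, 0 < n → (n : ℤ) ≤ C - f (p / q) := by
    intro n hn
    have h1 := hC n hn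
    have h2 := hf.step_eq (1 / (n * q)) (n * p)
    have hn' : (n : ℚ) ≠ 0 := by positivity
    rw [show ((n * p : ℕ) : ℚ) * (1 / (n * q)) = p / q by push_cast; field_simp] at h2
    push_cast at h2
    have h3 := hneg (1 / (n * q)) (by positivity)
    have hp' : (1 : ℤ) ≤ p := by exact_mod_cast hp
    nlinarith [mul_le_mul_of_nonneg_left hp' (show (0 : ℤ) ≤ n by omega)]
  have h1 := key ((C - f (p / q)).toNat + 1) (by omega)
  have h2 := Int.self_le_toNat (C - f (p / q))
  push_cast at h1
  omega

theorem IsSplitting.opposite (hf : S.IsSplitting f) :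
    S.opposite.IsSplitting fun r => f (-r) := by
  intro r s
  have h := hf (-r) (-s)
  rw [← neg_add] at h
  exact h

theorem IsSplitting.of_opposite (hf : S.opposite.IsSplitting f) :
    S.IsSplitting fun r => f (-r) := by
  intro r s
  have h := hf (-r) (-s)
  rw [← neg_add] at h
  simpa only [CentralSection.opposite, neg_neg] using h

theorem IsSplitting.ne_zero (hf : S.IsSplitting f) {r : ℚ} (h : S.B r * S.B (-r) ≠ 1) :
    f ≠ 0 := by
  rintro rfl
  have h1 := hf r (-r)
  simp [S.B_zero] at h1
  exact h h1.symm

end CentralSection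

/-! ### Translation between the cone and subsets of `K`. -/

section Sets

variable {F : Type*} [DivisionRing F]

theorem mem_leftMul {W : Subring F} {c x : F} : x ∈ leftMul W c ↔ ∃ w ∈ W, w * c = x := by
  rw [leftMul, Set.mul_singleton]
  rfl

theorem prod_subset_leftMul {W : Subring F} {c : F} {S T : Set F}
    (h : ∀ x ∈ S, ∀ y ∈ T, x * y ∈ leftMul W c) : prod S T ⊆ leftMul W c := by
  have h1 : ((W.toAddSubgroup.map (AddMonoidHom.mulRight c) : AddSubgroup F) : Set F) =
      leftMul W c := by
    rw [leftMul, Set.mul_singleton]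
    rfl
  rw [prod, ← h1, SetLike.coe_subset_coe, AddSubgroup.closure_le, h1]
  rintro _ ⟨x, hx, y, hy, rfl⟩
  exact h x hx y hy

theorem mul_mem_prod {S T : Set F} {x y : F} (hx : x ∈ S) (hy : y ∈ T) : x * y ∈ prod S T :=
  AddSubgroup.subset_closure (Set.mul_mem_mul hx hy)

theorem prod_subset {S T : Set F} {I : AddSubgroup F} (h : ∀ x ∈ S, ∀ y ∈ T, x * y ∈ I) :
    prod S T ⊆ I := by
  rw [prod, SetLike.coe_subset_coe, AddSubgroup.closure_le]
  rintro _ ⟨x, hx, y, hy, rfl⟩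
  exact h x hx y hy

end Sets

open HomUnits

variable {K : Type*} [DivisionRing K] [MulSemiringAction (Multiplicative ℚ) K]
variable {V : Subring K} {A : Subring (SkewGroupRing K)}

theorem mul_sigma_mem_comp {r s : ℚ} {a c : K} (ha : a ∈ comp A r) (hc : c ∈ comp A s) :
    a * sigma K r c ∈ comp A (r + s) := by
  have := A.mul_mem (mem_comp.1 ha) (mem_comp.1 hc)
  rwa [hom_mul_hom] at this

/-- `T` is the cone of `A`, with chosen generators, where `J(W) = b⁻¹ W`. -/
structure IsConeOf (T : GeneratedCone (HomUnits K)) (A : Subring (SkewGroupRing K)) (b : K) :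
    Prop where
  d_eq : ∀ g, T.d g = deg g
  mem_P : ∀ g, g ∈ T.P ↔ coef g ∈ comp A (deg g)
  mem_W : ∀ g, g ∈ T.W ↔ deg g = 0 ∧ coef g ∈ bigW A
  deg_b : deg T.b = 0
  coef_b : coef T.b = b

theorem exists_isConeOf (hV : IsTotalValuationRing V) (hA : IsGradedExtension V A) {b : K}
    (hb : b ≠ 0) (hJ : radical (bigW A) = {b⁻¹} * (bigW A : Set K))
    (ht : ∃ t : ℚ, leftOrder (comp A t) = bigW A) :
    ∃ T : GeneratedCone (HomUnits K), IsConeOf T A b := by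
  obtain ⟨T, hT⟩ := (coneOf hV hA hb hJ).exists_generatedCone (by
    obtain ⟨t, ht⟩ := ht
    refine ⟨t, ?_⟩
    rintro a ⟨ha, haW⟩ p hp rfl
    change coef (a * p) ∈ comp A (deg (a * p))
    rw [coef_mul_of_deg_zero ha, deg_mul, ha, zero_add]
    rw [← ht] at haW
    exact haW _ hp)
  refine ⟨T, ?_⟩
  constructor <;> simp only [hT]
  exacts [fun _ => rfl, fun _ => Iff.rfl, fun _ => Iff.rfl, rfl, rfl]

namespace IsConeOf

variable {T : GeneratedCone (HomUnits K)} {b : K} (H : IsConeOf T A b)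
include H

theorem deg_y (r : ℚ) : deg (T.y r) = r := by rw [← H.d_eq, T.d_y]

theorem b_ne_zero : b ≠ 0 := by rw [← H.coef_b]; exact coef_ne_zero _

theorem deg_b_zpow (n : ℤ) : deg (T.b ^ n) = 0 := by
  rw [← H.d_eq, T.d_zpow, H.d_eq, H.deg_b, mul_zero]

theorem coef_b_zpow (n : ℤ) : coef (T.b ^ n) = b ^ n := by
  have h : ∀ n : ℕ, coef (T.b ^ n) = b ^ n := by
    intro n
    induction n with
    | zero => simp
    | succ n ih =>
      have h0 : deg (T.b ^ n) = 0 := by simpa using H.deg_b_zpow n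
      rw [pow_succ, coef_mul_of_deg_zero h0, ih, H.coef_b, pow_succ]
  obtain ⟨n, rfl | rfl⟩ := n.eq_nat_or_neg
  · simpa using h n
  · have h0 : deg (T.b ^ n) = 0 := by simpa using H.deg_b_zpow n
    rw [zpow_neg, zpow_neg, zpow_natCast, zpow_natCast, coef_inv_of_deg_zero h0, h]

theorem coef_mul_inv_mem {g h : HomUnits K} (hd : deg g = deg h) :
    g * h⁻¹ ∈ T.W ↔ coef g * (coef h)⁻¹ ∈ bigW A := by
  rw [H.mem_W, coef_mul_inv hd, deg_mul, deg_inv, hd]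
  simp

theorem leftMul_subset {g h : HomUnits K} (hd : deg g = deg h) (hW : g * h⁻¹ ∈ T.W) :
    leftMul (bigW A) (coef g) ⊆ leftMul (bigW A) (coef h) := by
  rw [H.coef_mul_inv_mem hd] at hW
  intro x hx
  obtain ⟨w, hw, rfl⟩ := mem_leftMul.1 hx
  refine mem_leftMul.2 ⟨_, (bigW A).mul_mem hw hW, ?_⟩
  rw [mul_assoc, inv_mul_cancel_right₀ (coef_ne_zero h)]

theorem leftMul_eq {g h : HomUnits K} (hU : g * h⁻¹ ∈ T.U) :
    leftMul (bigW A) (coef g) = leftMul (bigW A) (coef h) := by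
  have hd : deg g = deg h := by
    have := GradedCone.d_of_mem_U hU
    rw [H.d_eq, deg_mul, deg_inv] at this
    linarith
  refine (H.leftMul_subset hd hU.1).antisymm (H.leftMul_subset hd.symm ?_)
  simpa using hU.2

theorem mem_iff_of_mem_E {g : HomUnits K} (hg : g ∈ T.E) (w : K) :
    w ∈ bigW A ↔ coef g * sigma K (deg g) w * (coef g)⁻¹ ∈ bigW A := by
  rcases eq_or_ne w 0 with rfl | hw
  · simp
  · have h := hg (HomUnits.mk 0 w hw)
    rw [H.mem_W, H.mem_W, coef_conj _ _ (deg_mk _ _ _)] at h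
    simpa using h

theorem leftMul_eq_rightMul {g : HomUnits K} (hg : g ∈ T.E) :
    leftMul (bigW A) (coef g) = rightMul (bigW A) (deg g) (coef g) := by
  ext x
  rw [mem_leftMul, rightMul, Set.singleton_mul]
  simp only [Set.mem_image, exists_exists_and_eq_and]
  constructor
  · rintro ⟨w, hw, rfl⟩
    refine ⟨sigma K (-deg g) ((coef g)⁻¹ * w * coef g), ?_, ?_⟩
    · change _ ∈ bigW A
      rw [H.mem_iff_of_mem_E hg, sigma_sigma_neg]
      simpa [mul_assoc, coef_ne_zero] using hw
    · rw [sigma_sigma_neg]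
      simp [mul_assoc, coef_ne_zero]
  · rintro ⟨w, hw, rfl⟩
    refine ⟨_, (H.mem_iff_of_mem_E hg w).1 hw, ?_⟩
    rw [inv_mul_cancel_right₀ (coef_ne_zero g)]

theorem prod_leftMul {g h : HomUnits K} (hg : g ∈ T.E) :
    prod (leftMul (bigW A) (coef g)) (sigma K (deg g) '' leftMul (bigW A) (coef h)) =
      leftMul (bigW A) (coef (g * h)) := by
  apply Set.Subset.antisymm
  · refine prod_subset_leftMul ?_
    rintro x hx _ ⟨y, hy, rfl⟩
    obtain ⟨w, hw, rfl⟩ := mem_leftMul.1 hx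
    obtain ⟨v, hv, rfl⟩ := mem_leftMul.1 hy
    refine mem_leftMul.2 ⟨_, (bigW A).mul_mem hw ((H.mem_iff_of_mem_E hg v).1 hv), ?_⟩
    rw [coef_mul, map_mul]
    simp [mul_assoc, coef_ne_zero]
  · intro x hx
    obtain ⟨w, hw, rfl⟩ := mem_leftMul.1 hx
    rw [coef_mul, ← mul_assoc]
    exact mul_mem_prod (mem_leftMul.2 ⟨w, hw, rfl⟩)
      (Set.mem_image_of_mem _ (mem_leftMul.2 ⟨1, (bigW A).one_mem, one_mul _⟩))

theorem WA_eq (r : ℚ) : WA A r = leftMul (bigW A) (coef (T.y r)) := by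
  apply Set.Subset.antisymm
  · refine prod_subset_leftMul fun w hw a ha => ?_
    rcases eq_or_ne a 0 with rfl | ha0
    · exact mem_leftMul.2 ⟨0, (bigW A).zero_mem, by simp⟩
    have h1 := T.gen (HomUnits.mk r a ha0) ((H.mem_P _).2 ha)
    rw [H.d_eq, deg_mk] at h1
    exact H.leftMul_subset (by rw [deg_mk, H.deg_y]) h1 (mem_leftMul.2 ⟨w, hw, rfl⟩)
  · intro x hx
    obtain ⟨w, hw, rfl⟩ := mem_leftMul.1 hx
    have h1 := (H.mem_P _).1 (T.y_mem r)
    rw [H.deg_y] at h1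
    exact mul_mem_prod hw h1

end IsConeOf

/-- The twisted products `γ_i` come from powers in the semidirect product, so the exponents of the
central extension are the nice maps. -/
theorem coef_zpow (g : HomUnits K) (i : ℤ) : coef (g ^ i) = gamma (deg g) (coef g) i := by
  have hdeg : ∀ n : ℕ, deg (g ^ n) = n * deg g := by
    intro n
    induction n with
    | zero => simp
    | succ n ih => rw [pow_succ, deg_mul, ih]; push_cast; ring
  have h : ∀ n : ℕ, coef (g ^ n) = gammaNat (deg g) (coef g) n := by
    intro n
    induction n with
    | zero => simp [gammaNat]
    | succ n ih => rw [pow_succ, coef_mul, ih, hdeg, gammaNat]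
  rw [gamma]
  split_ifs with hi
  · rw [← h]
    congr 1
    rw [← zpow_natCast, Int.toNat_of_nonneg hi]
  · rw [← h]
    have hi' : i = -((-i).toNat : ℤ) := by omega
    conv_lhs => rw [hi', zpow_neg, zpow_natCast, coef_inv, hdeg]
    congr 2
    rw [← neg_mul]
    congr 1
    exact_mod_cast hi'.symm

namespace IsConeOf

variable {T : GeneratedCone (HomUnits K)} {b : K} (H : IsConeOf T A b)
include H

theorem isNiceMapAt {s : ℚ} (hs : T.extension.B s * T.extension.B (-s) ≠ 1) :
    IsNiceMapAt A b s (T.extension.step s) := by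
  refine ⟨T.extension.isNiceMap_step hs, coef (T.y s), coef_ne_zero _, H.WA_eq s, ?_, fun i => ?_⟩
  · have := H.leftMul_eq_rightMul (T.y_mem_E s)
    rwa [H.deg_y] at this
  · have h1 := T.B_eq_zpow_mul_iff.1 (T.extension.step_spec s i)
    rw [H.WA_eq, H.leftMul_eq h1, coef_mul_of_deg_zero (H.deg_b_zpow _), H.coef_b_zpow,
      coef_zpow, H.deg_y]

theorem mem_radical_iff (hV : IsTotalValuationRing V) (hA : IsGradedExtension V A)
    {g : HomUnits K} (hg : deg g = 0) : coef g ∈ radical (bigW A) ↔ T.b * g ∈ T.W := by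
  rw [GradedExt.mem_radical_iff (isTotalValuationRing_bigW hV hA) (coef_ne_zero g), ← T.mem_J,
    H.mem_W, H.mem_W, coef_inv_of_deg_zero hg, deg_inv, hg]
  simp

/-- The degrees whose generators are not inverse to those of the opposite degree are cyclic of
Type (e). -/
theorem isCyclicTypeE (hV : IsTotalValuationRing V) (hA : IsGradedExtension V A) {r : ℚ}
    (h : T.y r * T.y (-r) ∉ T.U) :
    IsCyclicTypeE A r ∧ leftOrder (comp A r) = bigW A := by
  have hcomp : (comp A r : Set K) = leftMul (bigW A) (coef (T.y r)) := by
    rw [← H.WA_eq]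
    apply Set.Subset.antisymm
    · intro a ha
      rw [← one_mul a]
      exact mul_mem_prod (bigW A).one_mem ha
    · refine prod_subset fun w hw a ha => ?_
      rcases eq_or_ne w 0 with rfl | hw0
      · simp
      rcases eq_or_ne a 0 with rfl | ha0
      · simp
      have h1 := T.gen (HomUnits.mk r a ha0) ((H.mem_P _).2 ha)
      rw [H.d_eq, deg_mk] at h1
      have h2 := GeneratedCone.W_mul_y_mem h
        (T.W.mul_mem ((H.mem_W (HomUnits.mk 0 w hw0)).2 ⟨rfl, hw⟩) h1)
      rw [← mul_assoc, inv_mul_cancel_right, H.mem_P] at h2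
      simpa [coef_mul, sigma_zero] using h2
  have horder : leftOrder (comp A r) = bigW A := by
    refine le_antisymm (le_iSup (fun r => leftOrder (comp A r)) r) fun w hw x hx => ?_
    rw [← SetLike.mem_coe, hcomp] at hx ⊢
    obtain ⟨v, hv, rfl⟩ := mem_leftMul.1 hx
    exact mem_leftMul.2 ⟨w * v, (bigW A).mul_mem hw hv, mul_assoc _ _ _⟩
  refine ⟨⟨⟨coef (T.y r), coef_ne_zero _, ?_, ?_, ?_⟩, b, H.b_ne_zero, ?_⟩, horder⟩ <;>
    rw [horder]
  · exact hcomp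
  · have := H.leftMul_eq_rightMul (T.y_mem_E r)
    rw [H.deg_y] at this
    rw [hcomp, this]
  · ext x
    rw [Set.mul_singleton, Set.mem_image, SetLike.mem_coe]
    have hy := coef_ne_zero (T.y r)
    have h1 : (∃ j ∈ radical (bigW A), j * sigma K (-r) (coef (T.y r))⁻¹ = x) ↔
        x * sigma K (-r) (coef (T.y r)) ∈ radical (bigW A) := by
      constructor
      · rintro ⟨j, hj, rfl⟩
        rwa [mul_assoc, ← map_mul, inv_mul_cancel₀ hy, map_one, mul_one]
      · refine fun hx => ⟨_, hx, ?_⟩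
        rw [mul_assoc, ← map_mul, mul_inv_cancel₀ hy, map_one, mul_one]
    rw [h1]
    rcases eq_or_ne x 0 with rfl | hx0
    · simp [zero_mem_radical]
    have h2 := GeneratedCone.mem_P_iff_of_neg h (q := HomUnits.mk (-r) x hx0)
      (by rw [H.d_eq, deg_mk])
    rw [← H.mem_radical_iff hV hA (by rw [deg_mul, deg_mk, H.deg_y, neg_add_cancel]),
      H.mem_P, coef_mul] at h2
    exact h2
  · ext x
    have h1 : x ∈ leftMul (bigW A) b⁻¹ ↔ x * b ∈ bigW A := by
      rw [mem_leftMul]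
      constructor
      · rintro ⟨w, hw, rfl⟩
        rwa [inv_mul_cancel_right₀ H.b_ne_zero]
      · exact fun hx => ⟨_, hx, mul_inv_cancel_right₀ H.b_ne_zero _⟩
    rw [h1]
    rcases eq_or_ne x 0 with rfl | hx0
    · simp [zero_mem_radical]
    have h2 := H.mem_radical_iff hV hA (g := HomUnits.mk 0 x hx0) rfl
    rw [coef_mk] at h2
    have h3 := GradedCone.b_mem_E (S := T.toGradedCone) (HomUnits.mk 0 x hx0 * T.b)
    rw [← mul_assoc, mul_inv_cancel_right] at h3
    rw [h2, ← h3, H.mem_W, coef_mul_of_deg_zero rfl, H.coef_b, deg_mul, H.deg_b]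
    simp

theorem mul_neg_notMem_U (hV : IsTotalValuationRing V) (hA : IsGradedExtension V A) {r : ℚ}
    (h1 : IsCyclicTypeE A r) (h2 : leftOrder (comp A r) = bigW A) :
    T.y r * T.y (-r) ∉ T.U := by
  obtain ⟨⟨a, ha, h3, -, h4⟩, -⟩ := h1
  rw [h2] at h3 h4
  refine GeneratedCone.mul_neg_notMem_U (a := HomUnits.mk r a ha) ?_ ?_ ?_ ?_
  · rw [H.mem_P, coef_mk, deg_mk, ← SetLike.mem_coe, h3]
    exact mem_leftMul.2 ⟨1, (bigW A).one_mem, one_mul a⟩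
  · rw [H.d_eq, deg_mk]
  · intro q hq hd
    rw [H.d_eq] at hd
    rw [H.mem_P, hd, ← SetLike.mem_coe, h3] at hq
    obtain ⟨w, hw, h5⟩ := mem_leftMul.1 hq
    rw [H.coef_mul_inv_mem (by rw [hd, deg_mk]), ← h5, coef_mk, mul_inv_cancel_right₀ ha]
    exact hw
  · intro q hq hd
    rw [H.d_eq] at hd
    rw [H.mem_P, hd, ← SetLike.mem_coe, h4, Set.mul_singleton] at hq
    obtain ⟨j, hj, h5⟩ := hq
    rw [← H.mem_radical_iff hV hA (by rw [deg_mul, hd, deg_mk, neg_add_cancel]), coef_mul, hd,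
      coef_mk, ← h5]
    dsimp only
    rwa [mul_assoc, ← map_mul, inv_mul_cancel₀ ha, map_one, mul_one]

/-- Used to exclude Type (II) when no `1 / l` gives a base: the section is then additive, so
homogeneous elements factor in prescribed degrees. -/
theorem prod_comp_eq (ht : ∃ t : ℚ, leftOrder (comp A t) = bigW A)
    (h : ∀ l : ℕ, 0 < l → T.y (1 / l) * T.y (-(1 / l)) ∈ T.U) (r s : ℚ) :
    prod (comp A r) (sigma K r '' comp A s) = comp A (r + s) := by
  apply Set.Subset.antisymm
  · refine prod_subset ?_
    rintro a ha _ ⟨c, hc, rfl⟩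
    exact mul_sigma_mem_comp ha hc
  · intro x hx
    rcases eq_or_ne x 0 with rfl | hx0
    · exact (AddSubgroup.closure _).zero_mem
    obtain ⟨p, hp, p', hp', hd, hd', he⟩ := GeneratedCone.exists_factorization (by
      obtain ⟨t, ht⟩ := ht
      refine ⟨t, fun a ha p hp hd => ?_⟩
      rw [H.mem_W, ← ht] at ha
      rw [H.mem_P] at hp ⊢
      rw [H.d_eq] at hd
      rw [coef_mul_of_deg_zero ha.1, deg_mul, ha.1, zero_add]
      rw [hd] at hp ⊢
      exact ha.2 _ hp) h ((H.mem_P (HomUnits.mk (r + s) x hx0)).2 hx) (by rw [H.d_eq, deg_mk])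
    have h1 := congrArg coef he
    rw [H.d_eq] at hd hd'
    rw [H.mem_P] at hp hp'
    rw [coef_mk, coef_mul] at h1
    subst hd hd'
    rw [h1]
    exact mul_mem_prod hp (Set.mem_image_of_mem _ hp')

end IsConeOf
end GradedExt

/-! ### Bounds from the suprema, and the theorem. -/

namespace GradedExt

open HomUnits

variable {K : Type*} [DivisionRing K] [MulSemiringAction (Multiplicative ℚ) K]
variable {V : Subring K} {A : Subring (SkewGroupRing K)}
variable {T : GeneratedCone (HomUnits K)} {b : K}

/-- An integer family with supremum less than `⊤` in `EReal` is bounded. -/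
theorem exists_bound_of_sSup_lt_top {S : Set EReal} (h : sSup S < ⊤) {u : ℕ → ℤ}
    (hu : ∀ n, 0 < n → (((u n : ℤ) : ℝ) : EReal) ∈ S) : ∃ C : ℤ, ∀ n, 0 < n → u n ≤ C := by
  obtain ⟨C, hC, -⟩ := EReal.lt_iff_exists_real_btwn.1 h
  refine ⟨⌊C⌋, fun n hn => Int.le_floor.2 ?_⟩
  have := (le_sSup (hu n hn)).trans hC.le
  exact_mod_cast this

namespace IsConeOf

theorem exists_isBase (H : IsConeOf T A b) (hV : IsTotalValuationRing V)
    (hA : IsGradedExtension V A) (ht : ∃ t : ℚ, leftOrder (comp A t) = bigW A) {s : ℚ}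
    (hs : IsTypeII A s) : ∃ l : ℕ, IsBase A l := by
  by_contra! hl
  have h : ∀ l : ℕ, 0 < l → T.y (1 / l) * T.y (-(1 / l)) ∈ T.U := by
    intro l hl0
    by_contra hn
    exact hl l ⟨hl0, H.isCyclicTypeE hV hA hn⟩
  obtain ⟨i, j, -, -, h1 | h1⟩ := hs
  · exact h1 (H.prod_comp_eq ht h _ _)
  · rw [sub_eq_add_neg] at h1
    exact h1 (H.prod_comp_eq ht h _ _)

theorem B_mul_B_neg_ne_one (H : IsConeOf T A b) (hV : IsTotalValuationRing V)
    (hA : IsGradedExtension V A) {l : ℕ} (hl : IsBase A l) :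
    T.extension.B (1 / l) * T.extension.B (-(1 / l)) ≠ 1 := by
  rw [Ne, T.B_mul_B_eq_one_iff]
  exact H.mul_neg_notMem_U hV hA hl.2.1 hl.2.2

theorem B_mul_B_neg_ne_one_of_dvd (H : IsConeOf T A b) (hV : IsTotalValuationRing V)
    (hA : IsGradedExtension V A) {l : ℕ} (hl : IsBase A l) {n m : ℕ} (hn : 0 < n) (hm : 0 < m) :
    T.extension.B (1 / (n * (l * m))) * T.extension.B (-(1 / (n * (l * m)))) ≠ 1 := by
  apply T.extension.mul_neg_ne_one_of_mul (n * m)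
  have hl0 : (l : ℚ) ≠ 0 := by exact_mod_cast hl.1.ne'
  have hn0 : (n : ℚ) ≠ 0 := by exact_mod_cast hn.ne'
  have hm0 : (m : ℚ) ≠ 0 := by exact_mod_cast hm.ne'
  rw [show ((n * m : ℕ) : ℚ) * (1 / (n * (l * m))) = 1 / l by push_cast; field_simp]
  exact H.B_mul_B_neg_ne_one hV hA hl

theorem exists_bound_of_lSup (H : IsConeOf T A b) (hV : IsTotalValuationRing V)
    (hA : IsGradedExtension V A) {l : ℕ} (hl : IsBase A l) {m : ℚ} (hm : 0 < m)
    (h : lSup A b l m < ⊤) : ∃ p q : ℕ, 0 < p ∧ 0 < q ∧ ∃ C : ℤ, ∀ n : ℕ, 0 < n →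
      T.extension.step (1 / (n * q)) (n * p) ≤ C := by
  have hnum := Rat.num_pos.2 hm
  -- The common factor `l` in `p` and `q` is kept so that `1 / (n q)` and `n p` are the step and
  -- index in the definition of `lSup`. As `1 / l` is a multiple of each step, these steps inherit
  -- its non-degeneracy.
  refine ⟨m.num.toNat * l, l * m.den, Nat.mul_pos (by omega) hl.1,
    Nat.mul_pos hl.1 (Rat.den_pos _), exists_bound_of_sSup_lt_top h fun n hn => ?_⟩
  refine ⟨n, hn, T.extension.step (1 / (n * (l * m.den))),
    H.isNiceMapAt (H.B_mul_B_neg_ne_one_of_dvd hV hA hl hn (Rat.den_pos _)), ?_⟩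
  push_cast
  rw [Int.toNat_of_nonneg hnum.le, mul_assoc (n : ℤ)]

theorem exists_bound_of_kSup (H : IsConeOf T A b) (hV : IsTotalValuationRing V)
    (hA : IsGradedExtension V A) {l : ℕ} (hl : IsBase A l) {m : ℚ} (hm : 0 < m)
    (h : kSup A b l m < ⊤) : ∃ p q : ℕ, 0 < p ∧ 0 < q ∧ ∃ C : ℤ, ∀ n : ℕ, 0 < n →
      T.extension.opposite.step (1 / (n * q)) (n * p) ≤ C := by
  have hnum := Rat.num_pos.2 hm
  refine ⟨m.num.toNat * l, l * m.den, Nat.mul_pos (by omega) hl.1,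
    Nat.mul_pos hl.1 (Rat.den_pos _), exists_bound_of_sSup_lt_top h fun n hn => ?_⟩
  refine ⟨n, hn, T.extension.step (-(1 / (n * (l * m.den)))), H.isNiceMapAt ?_, ?_⟩
  · rw [neg_neg]
    exact fun h => H.B_mul_B_neg_ne_one_of_dvd hV hA hl hn (Rat.den_pos m)
      (mul_eq_one_comm.1 h)
  · rw [CentralSection.step_opposite]
    push_cast
    rw [Int.toNat_of_nonneg hnum.le, mul_assoc (n : ℤ)]

/-- A splitting of the central extension gives compatible generators. -/
theorem exists_generators (H : IsConeOf T A b) {f : ℚ → ℤ} (hf : T.extension.IsSplitting f) :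
    ∃ α : ℚ → K, α 0 = 1 ∧
      (∀ r : ℚ, WA A r = leftMul (bigW A) (b ^ f r * α r)) ∧
      (∀ r : ℚ, leftMul (bigW A) (α r) = rightMul (bigW A) r (α r)) ∧
      ∀ r s : ℚ,
        prod (leftMul (bigW A) (α r)) (sigma K r '' leftMul (bigW A) (α s)) =
          leftMul (bigW A) (α r * sigma K r (α s)) ∧
        leftMul (bigW A) (α r * sigma K r (α s)) = leftMul (bigW A) (α (r + s)) := by
  -- Dividing out `b ^ f r` turns the section into a homomorphism modulo `U`.
  let a : ℚ → T.E := fun r => T.bE ^ (-f r) * T.yE r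
  have hdeg : ∀ r, deg (a r : HomUnits K) = r := by
    intro r
    change deg (T.b ^ (-f r) * T.y r) = r
    rw [deg_mul, H.deg_b_zpow, H.deg_y, zero_add]
  have hcoef : ∀ r, coef (a r : HomUnits K) = b ^ (-f r) * coef (T.y r) := by
    intro r
    change coef (T.b ^ (-f r) * T.y r) = _
    rw [coef_mul_of_deg_zero (H.deg_b_zpow _), H.coef_b_zpow]
  have hmul : ∀ r s, coef (a r * a s : HomUnits K) =
      coef (a r : HomUnits K) * sigma K r (coef (a s : HomUnits K)) := by
    intro r s
    rw [coef_mul, hdeg]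
  refine ⟨fun r => coef (a r : HomUnits K), ?_, fun r => ?_, fun r => ?_, fun r s => ⟨?_, ?_⟩⟩
  · dsimp only
    rw [hcoef, hf.zero, T.y_zero]
    simp
  · dsimp only
    rw [H.WA_eq, hcoef, zpow_neg, mul_inv_cancel_left₀ (zpow_ne_zero _ H.b_ne_zero)]
  · have := H.leftMul_eq_rightMul (a r).2
    rwa [hdeg] at this
  · have := H.prod_leftMul (g := a r) (h := a s) (a r).2
    rwa [hdeg, hmul] at this
  · rw [← hmul]
    apply H.leftMul_eq
    have h1 : T.proj (a r * a s) = T.proj (a (r + s)) := by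
      simp only [a, map_mul, map_zpow]
      exact (hf r s).symm
    exact GradedCone.proj_eq_iff.1 h1

end IsConeOf

end GradedExt

theorem lemma4p11 {K : Type*} [DivisionRing K] [MulSemiringAction (Multiplicative ℚ) K]
    (V : Subring K) (hV : GradedExt.IsTotalValuationRing V) (hVK : V ≠ ⊤)
    (A : Subring (GradedExt.SkewGroupRing K)) (hA : GradedExt.IsGradedExtension V A)
    (hE : GradedExt.IsTypeE A)
    (b : K) (hb : b ≠ 0)
    (hJ : GradedExt.radical (GradedExt.bigW A) = {b⁻¹} * (GradedExt.bigW A : Set K))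
    (ht : ∃ t : ℚ, GradedExt.leftOrder (GradedExt.comp A t) = GradedExt.bigW A) :
    (∃ l : ℕ, GradedExt.IsBase A l) ∧
    ∀ l : ℕ, GradedExt.IsBase A l →
      (∃ m : ℚ, 0 < m ∧ (GradedExt.lSup A b l m < ⊤ ∨ GradedExt.kSup A b l m < ⊤)) →
      ∃ (f : ℚ → ℤ) (α : ℚ → K),
        GradedExt.IsGradedMap f ∧ f ≠ 0 ∧ α 0 = 1 ∧
        (∀ r : ℚ, GradedExt.WA A r = GradedExt.leftMul (GradedExt.bigW A) (b ^ f r * α r)) ∧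
        (∀ r : ℚ, GradedExt.leftMul (GradedExt.bigW A) (α r) =
          GradedExt.rightMul (GradedExt.bigW A) r (α r)) ∧
        (∀ r s : ℚ,
          GradedExt.prod (GradedExt.leftMul (GradedExt.bigW A) (α r))
              (GradedExt.sigma K r '' GradedExt.leftMul (GradedExt.bigW A) (α s)) =
            GradedExt.leftMul (GradedExt.bigW A) (α r * GradedExt.sigma K r (α s)) ∧
          GradedExt.leftMul (GradedExt.bigW A) (α r * GradedExt.sigma K r (α s)) =
            GradedExt.leftMul (GradedExt.bigW A) (α (r + s))) ∧
        ((∃ m : ℚ, 0 < m ∧ GradedExt.lSup A b l m < ⊤) →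
          f = GradedExt.fMapNeg 0 ∨
          ∃ d : ℝ, 0 < d ∧
            (f = GradedExt.fMap d ∨ f = GradedExt.fMapPos d ∨ f = GradedExt.fMapNeg d)) ∧
        ((∃ m : ℚ, 0 < m ∧ GradedExt.kSup A b l m < ⊤) →
          f = GradedExt.fMapPos 0 ∨
          ∃ d : ℝ, d < 0 ∧
            (f = GradedExt.fMap d ∨ f = GradedExt.fMapPos d ∨ f = GradedExt.fMapNeg d)) := by
  open GradedExt in
  obtain ⟨T, H⟩ := exists_isConeOf hV hA hb hJ ht
  obtain ⟨⟨s, -, hs⟩, -⟩ := hE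
  refine ⟨H.exists_isBase hV hA ht hs, fun l hl hm => ?_⟩
  have hl1 := H.B_mul_B_neg_ne_one hV hA hl
  obtain ⟨f, hf⟩ : ∃ f, T.extension.IsSplitting f := by
    obtain ⟨m, hm0, h | h⟩ := hm
    · obtain ⟨p, q, hp, hq, C, hC⟩ := H.exists_bound_of_lSup hV hA hl hm0 h
      exact T.extension.exists_splitting hp hq hC
    · obtain ⟨p, q, hp, hq, C, hC⟩ := H.exists_bound_of_kSup hV hA hl hm0 h
      obtain ⟨f, hf⟩ := T.extension.opposite.exists_splitting hp hq hC
      exact ⟨_, CentralSection.IsSplitting.of_opposite hf⟩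
  obtain ⟨α, h0, h1, h2, h3⟩ := H.exists_generators hf
  have hf0 := hf.ne_zero hl1
  refine ⟨f, α, hf.isGradedMap, hf0, h0, h1, h2, h3, ?_, ?_⟩
  -- The splitting may have come from the other bound; the present one is needed only for the sign
  -- of the slope, and any splitting gives it.
  · rintro ⟨m, hm0, h⟩
    obtain ⟨p, q, hp, hq, C, hC⟩ := H.exists_bound_of_lSup hV hA hl hm0 h
    obtain ⟨s, hs, hfs⟩ := hf.exists_nonneg hp hq hC
    exact hf.isGradedMap.classification_of_pos hf0 hs hfs
  · rintro ⟨m, hm0, h⟩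
    obtain ⟨p, q, hp, hq, C, hC⟩ := H.exists_bound_of_kSup hV hA hl hm0 h
    obtain ⟨s, hs, hfs⟩ := hf.opposite.exists_nonneg hp hq hC
    exact hf.isGradedMap.classification_of_neg hf0 (neg_neg_of_pos hs) hfs
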